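/- Let $P_1,\dots,P_N\in\mathbb R^n$ be points whose convex hull has dimension $n$, let $w_1,\dots,w_N\in\mathbb R$, and put $$g_i(x)=\tfrac12|x-P_i|^2-\tfrac12 w_i,\qquad g(x)=\min_{1\le i\le N} g_i(x),\qquad f(x)=\max_{1\le i\le N}\Bigl(\langle x,P_i\rangle-\tfrac12(|P_i|^2-w_i)\Bigr).$$ *Coherent triangulation.* For $\alpha\subset\{1,\dots,N\}$ let $\mathrm{Pow}(\alpha)$ be the closure of the set of all $x$ with $g_i(x)=g(x)$ for $i\in\alpha$ and $g_j(x)>g(x)$ for $j\notin\alpha$. The cells of the coherent triangulation are indexed by the sets $\alpha$ with $\mathrm{Pow}(\alpha)\neq\emptyset$; the cell of $\alpha$ is the polytope $$\mathrm{Del}(\alpha)=\{\xi : f(x)+\hat f(\xi)-\langle x,\xi\rangle=0\ \text{ for all } x\in\mathrm{Pow}(\alpha)\},\qquad \hat f(\xi)=\sup_x(\langle \xi,x\rangle-f(x)),$$ and its dimension is $\dim \mathrm{Del}(\alpha)$. *Active cells.* Let $\mathrm{Aff}(\alpha)$ and $\mathrm{CH}(\alpha)$ be the affine and the convex hull of $\{P_i: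 i\in\alpha\}$, let $\mathrm{Sep}(\alpha)=\{x: g_i(x)=g_j(x)\ \text{for all } i,j\in\alpha\}$, and $c(\alpha)=\mathrm{Sep}(\alpha)\cap\mathrm{Aff}(\alpha)$. A cell $\alpha$ is *active* if $c(\alpha)$ is a single point, this point lies in the relative interior of $\mathrm{CH}(\alpha)$, $g(c(\alpha))=g_i(c(\alpha))$ for some $i\in\alpha$, and $g(c(\alpha))<g_j(c(\alpha))$ for all $j\notin\alpha$. *Critical points.* A point $x$ is a *regular* point of a function $h:\mathbb R^n\to\mathbb R$ if there are local topological coordinates $y_1,\dots,y_n$ centred at $x$ (a homeomorphism from a neighbourhood of $x$ onto an open subset of $\mathbb R^n$, sending $x$ to $0$) in which $h=h(x)+y_i$ for some $i$; otherwise $x$ is *critical*. A critical point is nondegenerate of *index* $k$ ($0\le k\le n$) if in some local topological coordinates centred at $x$ $$h=h(x)-y_1^2-\dots-y_k^2+y_{k+1}^2+\dots+y_n^2 .$$ A *topological Morse function* is a continuous function all of whose critical points are nondegenerate. **Theorem.** The function $g$ is a topological Morse function, and $\alpha\mapsto c(\alpha)$ is a bijection from the set of active cells of the coherent triangulation onto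 the set of critical points of $g$. If $\alpha$ is an active cell of dimension $d$, then $c(\alpha)$ is a critical point of $g$ of index $d$. -/

import Mathlib

noncomputable section

namespace PowerDiagram

variable {n N : ℕ}

/-- The function `g_i(x) = ½ |x - P_i|² - ½ w_i`. -/
def gi (P : Fin N → EuclideanSpace ℝ (Fin n)) (w : Fin N → ℝ) (i : Fin N)
    (x : EuclideanSpace ℝ (Fin n)) : ℝ :=
  (1 / 2) * ‖x - P i‖ ^ 2 - (1 / 2) * w i

/-- The function `g = min_i g_i` (a minimum over a finite index set, nonempty in all uses). -/
def g (P : Fin N → EuclideanSpace ℝ (Fin n)) (w : Fin N → ℝ)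
    (x : EuclideanSpace ℝ (Fin n)) : ℝ :=
  ⨅ i, gi P w i x

/-- The affine function `f_i(x) = ⟨x, P_i⟩ + c_i` with `c_i = -(|P_i|² - w_i) / 2`. -/
def fi (P : Fin N → EuclideanSpace ℝ (Fin n)) (w : Fin N → ℝ) (i : Fin N)
    (x : EuclideanSpace ℝ (Fin n)) : ℝ :=
  inner ℝ x (P i) + -(‖P i‖ ^ 2 - w i) / 2

/-- The convex piecewise affine function `f = max_i f_i`. -/
def f (P : Fin N → EuclideanSpace ℝ (Fin n)) (w : Fin N → ℝ)
    (x : EuclideanSpace ℝ (Fin n)) : ℝ :=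
  ⨆ i, fi P w i x

/-- The Legendre transform `ξ ↦ sup_x (⟨ξ, x⟩ - h(x))`, with the value `⊤` when the supremum is
infinite. -/
def legendre (h : EuclideanSpace ℝ (Fin n) → ℝ) (ξ : EuclideanSpace ℝ (Fin n)) : EReal :=
  ⨆ x : EuclideanSpace ℝ (Fin n), ((inner ℝ ξ x - h x : ℝ) : EReal)

/-- The face `Pow(α)` of the power diagram: the closure of the set of points at which the minimum
`g` is attained by exactly the functions `g_i` with `i ∈ α`. -/
def Pow (P : Fin N → EuclideanSpace ℝ (Fin n)) (w : Fin N → ℝ) (α : Finset (Fin N)) :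
    Set (EuclideanSpace ℝ (Fin n)) :=
  closure {x | (∀ i ∈ α, gi P w i x = g P w x) ∧ ∀ j ∉ α, g P w x < gi P w j x}

/-- The polytope `Del(α)` dual to `Pow(α)`: all `ξ` with `f(x) + f̂(ξ) - ⟨x, ξ⟩ = 0` for every
`x ∈ Pow(α)`. -/
def Del (P : Fin N → EuclideanSpace ℝ (Fin n)) (w : Fin N → ℝ) (α : Finset (Fin N)) :
    Set (EuclideanSpace ℝ (Fin n)) :=
  {ξ | ∀ x ∈ Pow P w α,
    (f P w x : EReal) + legendre (f P w) ξ - ((inner ℝ x ξ : ℝ) : EReal) = 0}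

/-- The cells of the coherent triangulation, recorded by their index sets: `α` is a cell when the
dual face `Pow(α)` is nonempty; the cell itself is the polytope `Del(α)`. -/
def coherentTriangulation (P : Fin N → EuclideanSpace ℝ (Fin n)) (w : Fin N → ℝ) :
    Set (Finset (Fin N)) :=
  {α | (Pow P w α).Nonempty}

/-- The dimension of the cell `α`, i.e. of the polytope `Del(α)`. -/
def cellDim (P : Fin N → EuclideanSpace ℝ (Fin n)) (w : Fin N → ℝ) (α : Finset (Fin N)) : ℕ :=
  Module.finrank ℝ (vectorSpan ℝ (Del P w α))

/-- The separator `Sep(α)`: the intersection of the sets `{g_i = g_j}` for `i, j ∈ α`. For a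
one-element `α` it is the whole space. -/
def Sep (P : Fin N → EuclideanSpace ℝ (Fin n)) (w : Fin N → ℝ) (α : Finset (Fin N)) :
    Set (EuclideanSpace ℝ (Fin n)) :=
  {x | ∀ i ∈ α, ∀ j ∈ α, gi P w i x = gi P w j x}

/-- The set `c(α) = Sep(α) ∩ Aff(α)`. For a one-element `α = {i}` it is `{P_i}`. -/
def center (P : Fin N → EuclideanSpace ℝ (Fin n)) (w : Fin N → ℝ) (α : Finset (Fin N)) :
    Set (EuclideanSpace ℝ (Fin n)) :=
  Sep P w α ∩ (affineSpan ℝ (P '' (α : Set (Fin N))) : Set (EuclideanSpace ℝ (Fin n)))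

/-- A cell `α` is active when `c(α)` is a point of the relative interior of `CH(α)`, the minimum
`g` is attained there by a `g_i` with `i ∈ α`, and by no `g_j` with `j ∉ α`. -/
def IsActive (P : Fin N → EuclideanSpace ℝ (Fin n)) (w : Fin N → ℝ) (α : Finset (Fin N)) : Prop :=
  α ∈ coherentTriangulation P w ∧
    ∃ c, center P w α = {c} ∧
      c ∈ intrinsicInterior ℝ (convexHull ℝ (P '' (α : Set (Fin N)))) ∧
      (∃ i ∈ α, g P w c = gi P w i c) ∧
      ∀ j ∉ α, g P w c < gi P w j c

/-- `x` is a (topologically) regular point of `h`: in suitable local topological coordinates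
centred at `x`, the function `h - h(x)` is one of the coordinates. -/
def IsTopRegular (h : EuclideanSpace ℝ (Fin n) → ℝ) (x : EuclideanSpace ℝ (Fin n)) : Prop :=
  ∃ φ : OpenPartialHomeomorph (EuclideanSpace ℝ (Fin n)) (EuclideanSpace ℝ (Fin n)),
    x ∈ φ.source ∧ φ x = 0 ∧ ∃ i : Fin n, ∀ y ∈ φ.source, h y = h x + φ y i

/-- `x` is a (topologically) critical point of `h`: it is not regular. -/
def IsTopCritical (h : EuclideanSpace ℝ (Fin n) → ℝ) (x : EuclideanSpace ℝ (Fin n)) : Prop :=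
  ¬ IsTopRegular h x

/-- `x` is a nondegenerate critical point of `h` of index `k`: it is critical and, in suitable
local topological coordinates `y_1, …, y_n` centred at `x`, the function `h` is
`h(x) - y_1² - ⋯ - y_k² + y_{k+1}² + ⋯ + y_n²`. -/
def IsCriticalOfIndex (h : EuclideanSpace ℝ (Fin n) → ℝ) (x : EuclideanSpace ℝ (Fin n))
    (k : ℕ) : Prop :=
  IsTopCritical h x ∧ k ≤ n ∧
  ∃ φ : OpenPartialHomeomorph (EuclideanSpace ℝ (Fin n)) (EuclideanSpace ℝ (Fin n)),
    x ∈ φ.source ∧ φ x = 0 ∧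
    ∀ y ∈ φ.source, h y = h x + ∑ i : Fin n, (if (i : ℕ) < k then -(φ y i) ^ 2 else (φ y i) ^ 2)

/-- A topological Morse function: continuous, with nondegenerate critical points only. -/
def IsTopMorse (h : EuclideanSpace ℝ (Fin n) → ℝ) : Prop :=
  Continuous h ∧ ∀ x, IsTopCritical h x → ∃ k, IsCriticalOfIndex h x k

end PowerDiagram

end

/-! Near a point c only the set A of indices attaining the minimum matters, and expanding each g_i
about c gives g(c + h) = g(c) + ½|h|² − max_{i∈A} ⟨h, v_i⟩ with v_i = P_i − c
(`eventually_g_eq_localModel`). Everything depends on whether the v_i, i ∈ A, satisfy a linear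
relation with all coefficients positive, which for nonempty A means that c lies in the relative
interior of the convex hull of the P_i, i ∈ A.

If such a relation exists, the maximum depends only on the component of h in V = span(v_i), and is
bounded below there by a positive multiple of the norm of that component. Radial rescaling in V
turns the local form into −|y|² on V plus |y|² on its orthogonal complement
(`exists_morse_chart_localModel`). The index is dim V, and V is also the direction space of Del(A)
(`cellDim_minSet`).

If no such relation exists, a largest positively related subfamily F splits off, and the other
vectors lie strictly on one side of a hyperplane modulo span(v_i : i ∈ F). The local form then
strictly decreases along a family of lines which a local homeomorphism makes parallel, so c is
regular (`isTopRegular_localModel`).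

It remains to see that a point with a Morse normal form is not topologically regular
(`not_isTopRegular_of_chart`). Pushing the descending disc below the critical level, with its
boundary fixed, would contradict a theorem of Brouwer type (`exists_zero_of_eqOn_sphere`), which is
proved by a volume argument in the style of Milnor and Rogers.

Hence the critical points are exactly the points whose minimizing family is positively related, and
c ↦ `minSet P w c` inverts α ↦ c(α). -/

namespace PowerDiagram

open Set Metric Filter Topology MeasureTheory
open scoped RealInnerProductSpace

/-! ### Brouwer-type theorem by volume polynomials -/

section NoRetraction

variable {E : Type*} [NormedAddCommGroup E] [NormedSpace ℝ E]

/-- A Lipschitz map on a closed ball which vanishes on the bounding sphere extends by zero to a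
Lipschitz map with the same constant. -/
lemma lipschitzWith_zero_extension {u : E → E} {R : ℝ} {K : NNReal}
    (hu : LipschitzOnWith K u (closedBall 0 R)) (h0 : ∀ x, ‖x‖ = R → u x = 0) :
    LipschitzWith K (fun x => if ‖x‖ < R then u x else 0) := by
  -- The segment from an inner to an outer point meets the sphere, where u vanishes, at a point no
  -- farther from x than y is.
  have key : ∀ x y : E, ‖x‖ < R → ¬ ‖y‖ < R → dist (u x) 0 ≤ K * dist x y := by
    intro x y hx hy
    have hc : Continuous fun t : ℝ => ‖AffineMap.lineMap x y t‖ :=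
      (AffineMap.lineMap_continuous (p := x) (q := y)).norm
    obtain ⟨t, ht, htR⟩ := intermediate_value_Icc (zero_le_one' ℝ) hc.continuousOn
      (show R ∈ Icc _ _ by simpa using ⟨hx.le, not_lt.mp hy⟩)
    simp only at htR
    rw [← h0 _ htR]
    refine (hu.dist_le_mul x (by simpa using hx.le) _ (by simpa using htR.le)).trans ?_
    gcongr
    rw [dist_left_lineMap, Real.norm_of_nonneg ht.1]
    exact mul_le_of_le_one_left dist_nonneg ht.2
  refine LipschitzWith.of_dist_le_mul fun x y => ?_
  by_cases hx : ‖x‖ < R <;> by_cases hy : ‖y‖ < R <;> simp only [hx, hy, if_true, if_false]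
  · exact hu.dist_le_mul x (by simpa using hx.le) y (by simpa using hy.le)
  · exact key x y hx hy
  · rw [dist_comm, dist_comm x]; exact key y x hy hx
  · simp only [dist_self]; positivity

variable [FiniteDimensional ℝ E]

/-- The Neumann series makes every operator on the segment from 1 to 1 + tA invertible, so the
determinant keeps the sign it has at 1. -/
lemma det_one_add_smul_pos {A : E →L[ℝ] E} {t : ℝ} (h : ‖t • A‖ < 1) :
    0 < (1 + t • A : E →L[ℝ] E).det := by
  have hc : Continuous fun s : ℝ => (1 + s • (t • A) : E →L[ℝ] E).det :=
    ContinuousLinearMap.continuous_det.comp (by fun_prop)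
  have hne : ∀ s ∈ Icc (0 : ℝ) 1, (1 + s • (t • A) : E →L[ℝ] E).det ≠ 0 := by
    intro s hs
    have h1 : ‖-(s • (t • A))‖ < 1 := by
      rw [norm_neg, norm_smul, Real.norm_of_nonneg hs.1]
      exact (mul_le_of_le_one_left (norm_nonneg _) hs.2).trans_lt h
    have h2 : IsUnit (1 + s • (t • A) : E →L[ℝ] E) := by
      have := isUnit_one_sub_of_norm_lt_one h1
      rwa [sub_neg_eq_add] at this
    have h3 : IsUnit ((1 + s • (t • A) : E →L[ℝ] E) : E →ₗ[ℝ] E) :=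
      h2.map (ContinuousLinearMap.toLinearMapRingHom : (E →L[ℝ] E) →+* (E →ₗ[ℝ] E))
    exact (h3.map LinearMap.det).ne_zero
  by_contra hneg
  obtain ⟨s, hs, hs0⟩ := intermediate_value_Icc' (zero_le_one' ℝ) hc.continuousOn
    (show (0 : ℝ) ∈ Icc _ _ by
      refine ⟨by simpa using not_lt.mp hneg, ?_⟩
      simp [ContinuousLinearMap.det])
  exact hne s hs hs0

/-- The value at `1` of the polynomial `t ↦ det (1 + t A)` is a fixed affine combination of its
values at any sufficiently large finite set of nodes. -/
lemma exists_det_interpolation (E : Type*) [NormedAddCommGroup E] [NormedSpace ℝ E]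
    [FiniteDimensional ℝ E] {δ : ℝ} (hδ : 0 < δ) :
    ∃ (s : Finset ℕ) (v l : ℕ → ℝ), (∀ j, 0 < v j ∧ v j ≤ δ) ∧ ∑ j ∈ s, l j = 1 ∧
      ∀ A : E →L[ℝ] E, (1 + A : E →L[ℝ] E).det = ∑ j ∈ s, l j * (1 + v j • A : E →L[ℝ] E).det := by
  classical
  let b := Module.finBasis ℝ E
  let k := Module.finrank ℝ E
  -- The polynomial has degree at most k = dim E, so k + 1 distinct nodes in (0, δ] suffice. The
  -- weights are Lagrange basis values at 1 and do not depend on A, so the identity can later be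
  -- integrated over varying A.
  let v : ℕ → ℝ := fun j => δ / (j + 1)
  let s := Finset.range (k + 1)
  have hv : InjOn v s := by
    intro i _ j _ hij
    have hi : (0 : ℝ) < i + 1 := by positivity
    have hj : (0 : ℝ) < j + 1 := by positivity
    have h := (div_eq_div_iff hi.ne' hj.ne').mp hij
    have := mul_left_cancel₀ hδ.ne' h
    exact_mod_cast (add_right_cancel this).symm
  refine ⟨s, v, fun j => (Lagrange.basis s v j).eval (1 : ℝ), fun j => ⟨by positivity, ?_⟩, ?_, ?_⟩
  · exact div_le_self hδ.le (by linarith [(Nat.cast_nonneg j : (0 : ℝ) ≤ j)])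
  · have := congrArg (Polynomial.eval (1 : ℝ)) (Lagrange.sum_basis hv ⟨0, Finset.mem_range.mpr (Nat.succ_pos k)⟩)
    simpa only [Polynomial.eval_finsetSum, Polynomial.eval_one] using this
  · intro A
    let M := LinearMap.toMatrix b b (A : E →ₗ[ℝ] E)
    let p : Polynomial ℝ := ((Polynomial.X : Polynomial ℝ) • M.map Polynomial.C +
      (1 : Matrix (Fin k) (Fin k) ℝ).map Polynomial.C :
        Matrix (Fin k) (Fin k) (Polynomial ℝ)).det
    have hp : ∀ t, p.eval t = (1 + t • A : E →L[ℝ] E).det := by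
      intro t
      have e1 : ((1 + t • A : E →L[ℝ] E) : E →ₗ[ℝ] E) = LinearMap.id + t • (A : E →ₗ[ℝ] E) := rfl
      rw [ContinuousLinearMap.det, ← LinearMap.det_toMatrix b, e1, map_add, map_smul,
        LinearMap.toMatrix_id, ← Polynomial.coe_evalRingHom, RingHom.map_det]
      congr 1
      ext i j
      simp [M, Matrix.map_apply, Matrix.one_apply, add_comm]
      split_ifs <;> simp [mul_comm]
    have hdeg : p.degree < s.card := by
      refine (Polynomial.degree_le_natDegree).trans_lt ?_
      have := Polynomial.natDegree_det_X_add_C_le M 1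
      simp only [Fintype.card_fin] at this
      simp only [s, Finset.card_range]
      exact_mod_cast Nat.lt_succ_of_le this
    have h1 := congrArg (Polynomial.eval 1) (Lagrange.eq_interpolate hv hdeg)
    rw [hp, one_smul] at h1
    rw [h1, Lagrange.interpolate_apply, Polynomial.eval_finsetSum]
    refine Finset.sum_congr rfl fun j _ => ?_
    rw [Polynomial.eval_mul, Polynomial.eval_C, hp, mul_comm]

/-- A continuously differentiable map fixing a sphere pointwise cannot have everywhere vanishing
Jacobian determinant. -/
lemma not_det_fderiv_eq_zero [MeasurableSpace E] [BorelSpace E] (μ : Measure E)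
    [μ.IsAddHaarMeasure] {r : E → E} (hr : ContDiff ℝ 1 r) {R : ℝ} (hR : 0 < R)
    (hfix : ∀ x, ‖x‖ = R → r x = x) : ¬ ∀ x, (fderiv ℝ r x).det = 0 := by
  intro hdet
  let B : Set E := ball 0 R
  let A : E → E →L[ℝ] E := fun x => fderiv ℝ r x - 1
  have hAc : Continuous A := (hr.continuous_fderiv one_ne_zero).sub continuous_const
  have hdc : ∀ t : ℝ, Continuous fun x => (1 + t • A x : E →L[ℝ] E).det := fun t =>
    ContinuousLinearMap.continuous_det.comp (by fun_prop)
  have hint : ∀ t : ℝ, IntegrableOn (fun x => (1 + t • A x : E →L[ℝ] E).det) B μ := fun t =>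
    ((hdc t).continuousOn.integrableOn_compact (isCompact_closedBall 0 R)).mono_set
      ball_subset_closedBall
  have hud : ContDiff ℝ 1 (fun x => r x - x) := hr.sub contDiff_id
  obtain ⟨K, hK⟩ := (hud.contDiffOn (s := closedBall 0 R)).exists_lipschitzOnWith one_ne_zero
    (convex_closedBall 0 R) (isCompact_closedBall 0 R)
  have hU := lipschitzWith_zero_extension hK (fun x hx => by simp [hfix x hx])
  set U : E → E := fun x => if ‖x‖ < R then r x - x else 0 with hUdef
  have hUd : ∀ x ∈ B, HasFDerivAt U (A x) x := by
    intro x hx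
    have h1 : HasFDerivAt (fun x => r x - x) (A x) x :=
      ((hr.differentiable one_ne_zero) x).hasFDerivAt.sub (hasFDerivAt_id x)
    refine h1.congr_of_eventuallyEq ?_
    filter_upwards [isOpen_ball.mem_nhds hx] with y hy
    simp only [hUdef, mem_ball_zero_iff.mp hy, if_true]
  have hAn : ∀ x ∈ B, ‖A x‖ ≤ K := fun x hx => (hUd x hx).le_of_lipschitz hU
  let δ : ℝ := 1 / (K + 2)
  have hδ : 0 < δ := by positivity
  -- For small t the map T = id + tU is a bijection fixing the complement of the ball, so it maps
  -- the ball onto itself and its Jacobian integrates to the volume.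
  have hvol : ∀ t : ℝ, 0 < t → t ≤ δ →
      ∫ x in B, (1 + t • A x : E →L[ℝ] E).det ∂μ = μ.real B := by
    intro t ht htδ
    have htK : t * K < 1 := by
      have : t * (K + 2) ≤ 1 := by
        rw [← div_mul_cancel₀ (1 : ℝ) (show (K + 2 : ℝ) ≠ 0 by positivity)]
        gcongr
      nlinarith
    let T : E → E := fun x => x + t • U x
    have hT : ApproximatesLinearOn T ((ContinuousLinearEquiv.refl ℝ E : E ≃L[ℝ] E) : E →L[ℝ] E)
        univ (⟨t, ht.le⟩ * K) := by
      intro x _ y _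
      have h1 : T x - T y - ((ContinuousLinearEquiv.refl ℝ E : E ≃L[ℝ] E) : E →L[ℝ] E) (x - y)
          = t • (U x - U y) := by
        simp only [T, ContinuousLinearEquiv.coe_refl, ContinuousLinearMap.id_apply, smul_sub]; abel
      rw [h1, norm_smul, Real.norm_of_nonneg ht.le]
      have := hU.dist_le_mul x y
      rw [dist_eq_norm, dist_eq_norm] at this
      calc t * ‖U x - U y‖ ≤ t * (K * ‖x - y‖) := by gcongr
        _ = _ := by rw [← mul_assoc]; rfl
    have hcc : Subsingleton E ∨ (⟨t, ht.le⟩ * K : NNReal) <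
        ‖((ContinuousLinearEquiv.refl ℝ E).symm : E →L[ℝ] E)‖₊⁻¹ := by
      rcases subsingleton_or_nontrivial E with h | h
      · exact Or.inl h
      · right
        have : ‖((ContinuousLinearEquiv.refl ℝ E).symm : E →L[ℝ] E)‖₊ = 1 := by
          simp [ContinuousLinearEquiv.refl_symm, ContinuousLinearEquiv.coe_refl]
        rw [this, inv_one]
        exact_mod_cast htK
    have hinj : Function.Injective T := fun x y h => by
      have := hT.injOn hcc (mem_univ x) (mem_univ y) h
      exact this
    have hsurj : Function.Surjective T := hT.surjective hcc
    have hTout : ∀ x, x ∉ B → T x = x := by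
      intro x hx
      have : ¬ ‖x‖ < R := by simpa [B] using hx
      simp [T, hUdef, this]
    have himg : T '' B = B := by
      apply Subset.antisymm
      · rintro _ ⟨x, hx, rfl⟩
        by_contra hcon
        have := hinj (hTout _ hcon)
        rw [this] at hcon
        exact hcon hx
      · intro y hy
        obtain ⟨x, rfl⟩ := hsurj y
        refine ⟨x, ?_, rfl⟩
        by_contra hcon
        rw [hTout x hcon] at hy
        exact hcon hy
    have hTd : ∀ x ∈ B, HasFDerivWithinAt T (1 + t • A x) B x := fun x hx =>
      ((hasFDerivAt_id x).add ((hUd x hx).const_smul t)).hasFDerivWithinAt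
    have hcv := integral_image_eq_integral_abs_det_fderiv_smul μ measurableSet_ball hTd
      hinj.injOn (fun _ => (1 : ℝ))
    rw [himg] at hcv
    simp only [integral_const, smul_eq_mul, mul_one, measureReal_restrict_apply_univ] at hcv
    rw [hcv]
    refine setIntegral_congr_fun measurableSet_ball fun x hx => ?_
    refine (abs_of_pos (det_one_add_smul_pos ?_)).symm
    rw [norm_smul, Real.norm_of_nonneg ht.le]
    exact (mul_le_mul_of_nonneg_left (hAn x hx) ht.le).trans_lt htK
  -- Interpolation carries the volume identity from small t to t = 1, where the integrand is det r′
  -- = 0.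
  obtain ⟨s, v, l, hv, hl, hsum⟩ := exists_det_interpolation E hδ
  have h1 : ∫ x in B, (1 + A x : E →L[ℝ] E).det ∂μ = μ.real B := by
    rw [integral_congr_ae (Eventually.of_forall fun x => hsum (A x)),
      integral_finsetSum _ fun j _ => (hint (v j)).const_mul (l j)]
    simp_rw [integral_const_mul]
    rw [Finset.sum_congr rfl fun j _ => by rw [hvol (v j) (hv j).1 (hv j).2], ← Finset.sum_mul,
      hl, one_mul]
  have h2 : ∀ x, (1 + A x : E →L[ℝ] E).det = 0 := by
    intro x
    have e : (1 + A x : E →L[ℝ] E) = fderiv ℝ r x := add_sub_cancel _ _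
    rw [e, hdet x]
  simp only [h2, integral_zero] at h1
  exact (ENNReal.toReal_pos (measure_ball_pos μ (0 : E) hR).ne' measure_ball_lt_top.ne).ne h1

end NoRetraction

/-- A continuous self-map of Euclidean space which is the identity on the unit sphere has a zero in
the closed unit ball. -/
lemma exists_zero_of_eqOn_sphere {k : ℕ} {F : EuclideanSpace ℝ (Fin k) → EuclideanSpace ℝ (Fin k)}
    (hF : ContinuousOn F (closedBall 0 1)) (hid : ∀ x, ‖x‖ = 1 → F x = x) :
    ∃ x, ‖x‖ ≤ 1 ∧ F x = 0 := by
  by_contra! hne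
  let F' : EuclideanSpace ℝ (Fin k) → EuclideanSpace ℝ (Fin k) := fun x => if ‖x‖ ≤ 1 then F x else x
  have hF' : Continuous F' := by
    refine continuous_if_le continuous_norm continuous_const ?_ continuousOn_id
      (fun x hx => hid x hx)
    exact hF.mono fun x hx => by simpa using hx
  have hF'0 : ∀ x, F' x ≠ 0 := by
    intro x
    by_cases hx : ‖x‖ ≤ 1
    · simpa [F', hx] using hne x hx
    · simp only [F', hx, if_false]
      rintro rfl
      simp at hx
  let U : Set (EuclideanSpace ℝ (Fin k)) := (closedBall 0 1)ᶜ
  -- The extension is known to be smooth only outside the closed unit ball; the smoothing may alter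
  -- it in the shell up to radius 2, so the retraction is built onto the sphere of radius 2.
  let S : Set (EuclideanSpace ℝ (Fin k)) := (ball 0 2)ᶜ
  have hS : IsClosed S := isOpen_ball.isClosed_compl
  have hU : U ∈ 𝓝ˢ S := by
    rw [isClosed_closedBall.isOpen_compl.mem_nhdsSet]
    intro x hx
    simp only [S, mem_compl_iff, mem_ball_zero_iff, mem_closedBall_zero_iff, not_lt, not_le] at *
    linarith
  have hUs : ContDiffOn ℝ ((1 : ℕ∞) : WithTop ℕ∞) F' U := by
    refine contDiffOn_id.congr fun x hx => ?_
    have : ¬ ‖x‖ ≤ 1 := by simpa [U] using hx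
    simp [F', this]
  -- Approximation with error below ‖F'‖ keeps G free of zeros.
  obtain ⟨G, hG, hGd, hGS, -⟩ := hF'.exists_contDiff_approx_and_eqOn (1 : ℕ∞) hF'.norm
    (fun x => norm_pos_iff.mpr (hF'0 x)) hS hU hUs
  have hG0 : ∀ x, G x ≠ 0 := by
    intro x h0
    have := hGd x
    rw [h0, dist_zero_left] at this
    exact lt_irrefl _ this
  let r : EuclideanSpace ℝ (Fin k) → EuclideanSpace ℝ (Fin k) := fun x => (2 * ‖G x‖⁻¹) • G x
  have hG1 : ContDiff ℝ 1 G := hG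
  have hr : ContDiff ℝ 1 r :=
    (contDiff_const.mul ((hG1.norm ℝ hG0).inv fun x => norm_ne_zero_iff.mpr (hG0 x))).smul hG1
  have hrn : ∀ x, ‖r x‖ = 2 := by
    intro x
    have := norm_ne_zero_iff.mpr (hG0 x)
    simp only [r, norm_smul, norm_mul, norm_inv, norm_norm]
    field_simp
    simp
  have hfix : ∀ x, ‖x‖ = 2 → r x = x := by
    intro x hx
    have h1 : G x = x := by
      rw [hGS (by simp [S, hx])]
      simp [F', hx]
    simp [r, h1, hx]
  refine not_det_fderiv_eq_zero volume hr two_pos hfix fun x => ?_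
  -- Since ‖r‖ is constant, the image of r′(x) is orthogonal to r(x); an invertible r′(x) would have
  -- r(x) itself in its image.
  by_contra hdet
  have hd := ((hr.differentiable one_ne_zero) x).hasFDerivAt
  have h1 : HasFDerivAt (fun y => ‖r y‖ ^ 2) _ x := hd.norm_sq
  have h2 : HasFDerivAt (fun y => ‖r y‖ ^ 2) (0 : EuclideanSpace ℝ (Fin k) →L[ℝ] ℝ) x := by
    simp only [hrn]
    exact hasFDerivAt_const _ _
  have h3 := h1.unique h2
  obtain ⟨y, hy⟩ := (LinearMap.equivOfDetNeZero _ hdet).surjective (r x)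
  have hy' : fderiv ℝ r x y = r x := hy
  have h4 := DFunLike.congr_fun h3 y
  simp [hy', hrn] at h4

/-- Cutting the source down to U ∩ f⁻¹(V), and the target likewise, means that images need not be
computed and the inverse identities are only needed where both maps are defined. -/
lemma exists_openPartialHomeomorph {X Y : Type*} [TopologicalSpace X] [TopologicalSpace Y]
    {f : X → Y} {g : Y → X} {U : Set X} {V : Set Y} (hU : IsOpen U) (hV : IsOpen V)
    (hf : ContinuousOn f U) (hg : ContinuousOn g V) (hgf : ∀ x ∈ U, f x ∈ V → g (f x) = x)
    (hfg : ∀ y ∈ V, g y ∈ U → f (g y) = y) :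
    ∃ φ : OpenPartialHomeomorph X Y, φ.source = U ∩ f ⁻¹' V ∧ ⇑φ = f :=
  ⟨{  toFun := f
      invFun := g
      source := U ∩ f ⁻¹' V
      target := V ∩ g ⁻¹' U
      map_source' := fun x hx => ⟨hx.2, by rw [mem_preimage, hgf x hx.1 hx.2]; exact hx.1⟩
      map_target' := fun y hy => ⟨hy.2, by rw [mem_preimage, hfg y hy.1 hy.2]; exact hy.1⟩
      left_inv' := fun x hx => hgf x hx.1 hx.2
      right_inv' := fun y hy => hfg y hy.1 hy.2
      open_source := hf.isOpen_inter_preimage hU hV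
      open_target := hg.isOpen_inter_preimage hV hU
      continuousOn_toFun := hf.mono inter_subset_left
      continuousOn_invFun := hg.mono inter_subset_left }, rfl, rfl⟩

/-! ### Criteria for topological regularity and criticality -/

section Regularity

variable {n : ℕ}

local notation "𝔼" => EuclideanSpace ℝ (Fin n)

lemma IsTopRegular.of_comp {h H : 𝔼 → ℝ} {y : 𝔼} (T : OpenPartialHomeomorph 𝔼 𝔼)
    (hy : y ∈ T.source) {a : ℝ} (hT : ∀ z ∈ T.source, h (T z) = a + H z) (hreg : IsTopRegular H y) :
    IsTopRegular h (T y) := by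
  obtain ⟨φ, hs, h0, i, hi⟩ := hreg
  refine ⟨T.symm.trans φ, ?_, ?_, i, ?_⟩
  · simp [hy, hs]
  · simp [hy, h0]
  · intro z hz
    simp only [OpenPartialHomeomorph.trans_source, OpenPartialHomeomorph.symm_source,
      mem_inter_iff, mem_preimage] at hz
    have h1 := hT _ (T.map_target hz.1)
    rw [T.right_inv hz.1] at h1
    rw [h1, hT y hy, hi _ hz.2, add_assoc]
    rfl

/-- The i-th coordinate is replaced by H − H(x). Strict monotonicity on the coordinate lines gives
injectivity, and the intermediate value theorem on nearby lines gives openness; no differentiability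
is needed. -/
lemma IsTopRegular.of_antitone_coord {H : 𝔼 → ℝ} (hH : Continuous H) {x : 𝔼} {r : ℝ} (hr : 0 < r)
    (i : Fin n)
    (hanti : ∀ (y : 𝔼) (t : ℝ), 0 < t → y ∈ ball x r → y + t • EuclideanSpace.single i 1 ∈ ball x r →
      H (y + t • EuclideanSpace.single i 1) < H y) : IsTopRegular H x := by
  set b : 𝔼 := EuclideanSpace.single i 1 with hb
  have hbi : b i = 1 := by simp [hb]
  have hbn : ‖b‖ = 1 := by simp [hb]
  let φ : 𝔼 → 𝔼 := fun y => (y - x) + (H y - H x - (y - x) i) • b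
  have hci : Continuous fun y : 𝔼 => y i := by fun_prop
  have hφ : Continuous φ := by
    have : Continuous fun y : 𝔼 => (y - x) i := hci.comp (continuous_id.sub continuous_const)
    fun_prop
  have hφi : ∀ y, φ y i = H y - H x := by intro y; simp [φ, hbi]
  have hinj : InjOn φ (ball x r) := by
    have key : ∀ y ∈ ball x r, ∀ z ∈ ball x r, φ y = φ z → ¬ y i < z i := by
      intro y hy z hz hyz hlt
      have hHeq : H y = H z := by
        have := congrArg (fun u : 𝔼 => u i) hyz
        simp only [hφi] at this
        linarith
      have hz' : z = y + (z i - y i) • b := by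
        have h1 : (z - x) - (y - x) = (φ z - φ y) + ((H y - (y - x) i) - (H z - (z - x) i)) • b := by
          simp only [φ]; module
        rw [hyz, sub_self, zero_add, hHeq] at h1
        have h2 : H z - (y - x) i - (H z - (z - x) i) = z i - y i := by
          simp
        rw [h2] at h1
        rw [← h1]; abel
      have := hanti y (z i - y i) (by linarith) hy (by rw [← hz']; exact hz)
      rw [← hz'] at this
      linarith
    intro y hy z hz hyz
    have heq : y i = z i := le_antisymm (not_lt.mp (key z hz y hy hyz.symm))
      (not_lt.mp (key y hy z hz hyz))
    have hHeq : H y = H z := by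
      have := congrArg (fun u : 𝔼 => u i) hyz
      simp only [hφi] at this
      linarith
    have h1 : y - x = z - x := by
      have : φ y - (H y - H x - (y - x) i) • b = φ z - (H z - H x - (z - x) i) • b := by
        simp only [hyz, hHeq, PiLp.sub_apply, heq]
      simpa [φ] using this
    exact sub_left_injective h1
  have hopen : ∀ y ∈ ball x r, ∀ W ∈ 𝓝 y, φ '' W ∈ 𝓝 (φ y) := by
    intro y hy W hW
    obtain ⟨δ, hδ, hδW⟩ := nhds_basis_ball.mem_iff.mp (inter_mem hW (isOpen_ball.mem_nhds hy))
    set η := δ / 2 with hη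
    -- `p z t` has i-th coordinate t and the other coordinates of x + z, so a preimage of z is found
    -- by solving H(p z t) = z_i + H(x) for t.
    let p : 𝔼 → ℝ → 𝔼 := fun z t => x + z + (t - x i - z i) • b
    have hp : ∀ t, Continuous fun z => p z t := by intro t; fun_prop
    have hpt : ∀ z, Continuous (p z) := by intro z; fun_prop
    have hpy : ∀ t, p (φ y) t = y + (t - y i) • b := by
      intro t
      simp only [p, hφi]
      simp only [φ, PiLp.sub_apply]
      module
    have hyη : ∀ s, |s| ≤ η → y + s • b ∈ ball y δ := by
      intro s hs
      rw [mem_ball_iff_norm, add_sub_cancel_left, norm_smul, hbn, mul_one, Real.norm_eq_abs]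
      linarith
    have hlow : H (y + η • b) < H y :=
      hanti y η (by positivity) hy (hδW (hyη η (by rw [abs_of_pos (by positivity)]))).2
    have hhigh : H y < H (y + (-η) • b) := by
      have h1 := hanti (y + (-η) • b) η (by positivity)
        (hδW (hyη (-η) (by rw [abs_neg, abs_of_pos (by positivity)]))).2
      have h2 : y + (-η) • b + η • b = y := by module
      rw [h2] at h1
      exact h1 hy
    have e1 : ∀ᶠ z in 𝓝 (φ y), H (p z (y i + η)) < z i + H x := by
      refine ContinuousAt.eventually_lt (hH.comp (hp _)).continuousAt
        (hci.add continuous_const).continuousAt ?_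
      rw [hpy, hφi, add_sub_cancel_left]; linarith
    have e2 : ∀ᶠ z in 𝓝 (φ y), z i + H x < H (p z (y i - η)) := by
      refine ContinuousAt.eventually_lt (hci.add continuous_const).continuousAt
        (hH.comp (hp _)).continuousAt ?_
      rw [hpy, hφi]
      have : y i - η - y i = -η := by ring
      rw [this]; linarith
    have e3 : ∀ᶠ z in 𝓝 (φ y), p z (y i) ∈ ball y η := by
      refine (hp (y i)).continuousAt.eventually_mem (isOpen_ball.mem_nhds ?_)
      rw [hpy]; simp; positivity
    filter_upwards [e1, e2, e3] with z h1 h2 h3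
    obtain ⟨t, ht, hHt⟩ := intermediate_value_Icc' (show y i - η ≤ y i + η by linarith [half_pos hδ])
      (hH.comp (hpt z)).continuousOn (show z i + H x ∈ Icc _ _ from ⟨h1.le, h2.le⟩)
    refine ⟨p z t, (hδW ?_).1, ?_⟩
    · have : p z t = p z (y i) + (t - y i) • b := by simp only [p]; module
      rw [mem_ball_iff_norm, this, add_sub_right_comm]
      refine (norm_add_le _ _).trans_lt ?_
      rw [norm_smul, hbn, mul_one, Real.norm_eq_abs]
      rw [mem_ball_iff_norm] at h3
      have : |t - y i| ≤ η := abs_le.mpr ⟨by linarith [ht.1], by linarith [ht.2]⟩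
      linarith
    · simp only [Function.comp_apply] at hHt
      simp only [φ, hHt, p]
      simp only [PiLp.sub_apply, PiLp.add_apply, PiLp.smul_apply, hbi, smul_eq_mul]
      module
  refine ⟨OpenPartialHomeomorph.ofContinuousOpenRestrict (hinj.toPartialEquiv) hφ.continuousOn ?_
    isOpen_ball, mem_ball_self hr, ?_, i, ?_⟩
  · refine IsOpenMap.of_nhds_le fun y S hS => ?_
    obtain ⟨W, hW, hWS⟩ := mem_nhds_subtype _ _ _ |>.mp (mem_map.mp hS)
    refine mem_of_superset (hopen y y.2 _ (inter_mem hW (isOpen_ball.mem_nhds y.2))) ?_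
    rintro _ ⟨z, ⟨hzW, hz⟩, rfl⟩
    exact hWS (a := ⟨z, hz⟩) hzW
  · show φ x = 0
    simp [φ]
  · intro y _
    show H y = H x + φ y i
    rw [hφi]; ring

lemma IsTopRegular.of_antitone_line {H : 𝔼 → ℝ} (hH : Continuous H) {e : 𝔼} (he : e ≠ 0) {r : ℝ}
    (hr : 0 < r)
    (hanti : ∀ (y : 𝔼) (t : ℝ), 0 < t → ‖y‖ < r → ‖y + t • e‖ < r → H (y + t • e) < H y) :
    IsTopRegular H 0 := by
  -- Only the existence of an index is needed: a linear isomorphism takes any chosen basis vector to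
  -- e.
  obtain ⟨i, -⟩ : ∃ i, e i ≠ 0 := by
    by_contra! hcon
    exact he (by ext i; simpa using hcon i)
  obtain ⟨A, hA⟩ := SeparatingDual.exists_continuousLinearEquiv_apply_eq (R := ℝ)
    (x := (EuclideanSpace.single i 1 : 𝔼)) (y := e) (by simp) he
  obtain ⟨δ, hδ, hδr⟩ := Metric.nhds_basis_ball.mem_iff.mp
    (A.continuous.continuousAt.preimage_mem_nhds (x := 0) (by rw [map_zero]; exact ball_mem_nhds 0 hr))
  have h1 : IsTopRegular (H ∘ A) 0 := by
    refine IsTopRegular.of_antitone_coord (hH.comp A.continuous) hδ i fun y t ht hy hyt => ?_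
    have h2 := hδr hy
    have h3 := hδr hyt
    simp only [mem_preimage, mem_ball_zero_iff, map_add, map_smul, hA] at h2 h3
    simp only [Function.comp_apply, map_add, map_smul, hA]
    exact hanti _ t ht h2 h3
  have := IsTopRegular.of_comp (h := H) A.toHomeomorph.toOpenPartialHomeomorph (y := 0) (by simp)
    (fun z _ => (zero_add _).symm) h1
  simpa using this

/-- A function with a Morse normal form in a topological chart around `x` is not regular at `x`. -/
lemma not_isTopRegular_of_chart {h : 𝔼 → ℝ} {x : 𝔼} {k : ℕ} (hk : k ≤ n)
    (φ : OpenPartialHomeomorph 𝔼 𝔼) (hx : x ∈ φ.source) (hφx : φ x = 0)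
    (hφ : ∀ y ∈ φ.source,
      h y = h x + ∑ i : Fin n, (if (i : ℕ) < k then -(φ y i) ^ 2 else (φ y i) ^ 2)) :
    ¬ IsTopRegular h x := by
  rintro ⟨θ, hxθ, hθx, i, hθ⟩
  set b : 𝔼 := EuclideanSpace.single i 1 with hb
  have hbi : b i = 1 := by simp [hb]
  -- J embeds the descending coordinates and q reads them off. Along J the quadratic form is
  -- nonpositive; on the kernel of q it is nonnegative.
  let J : EuclideanSpace ℝ (Fin k) → 𝔼 := fun a =>
    WithLp.toLp 2 fun j : Fin n => if hj : (j : ℕ) < k then a ⟨j, hj⟩ else 0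
  let q : 𝔼 → EuclideanSpace ℝ (Fin k) := fun z => WithLp.toLp 2 fun j => z (Fin.castLE hk j)
  have hJc : Continuous J := by
    refine (PiLp.continuous_toLp 2 _).comp (continuous_pi fun j => ?_)
    by_cases hj : (j : ℕ) < k
    · simp only [hj, dite_true]; fun_prop
    · simp only [hj, dite_false]; fun_prop
  have hqc : Continuous q := by
    refine (PiLp.continuous_toLp 2 _).comp (continuous_pi fun j => ?_)
    fun_prop
  have hqJ : ∀ a, q (J a) = a := by
    intro a; ext j; simp [q, J]
  have hJ0 : J 0 = 0 := by ext j; simp [J]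
  have hquad : ∀ a, ∑ j : Fin n, (if (j : ℕ) < k then -(J a j) ^ 2 else (J a j) ^ 2) ≤ 0 := by
    intro a
    refine Finset.sum_nonpos fun j _ => ?_
    by_cases hj : (j : ℕ) < k
    · simp only [hj, if_true]; nlinarith [sq_nonneg (J a j)]
    · simp [J, hj]
  have hφ0 : φ.symm 0 = x := by rw [← hφx, φ.left_inv hx]
  have h0t : (0 : 𝔼) ∈ φ.target := hφx ▸ φ.map_source hx
  have h0θ : (0 : 𝔼) ∈ θ.target := hθx ▸ θ.map_source hxθ
  have hθ0 : θ.symm 0 = x := by rw [← hθx, θ.left_inv hxθ]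
  have c1 : ContinuousAt (fun z => θ (φ.symm z)) 0 := by
    refine ContinuousAt.comp ?_ (φ.symm.continuousAt h0t)
    rw [hφ0]; exact θ.continuousAt hxθ
  have g1 : ∀ᶠ z in 𝓝 (0 : 𝔼), z ∈ φ.target ∧ φ.symm z ∈ θ.source :=
    (φ.open_target.eventually_mem h0t).and
      ((φ.symm.continuousAt h0t).eventually_mem (by rw [hφ0]; exact θ.open_source.mem_nhds hxθ))
  have g2 : ∀ᶠ z in 𝓝 (0 : 𝔼), z ∈ θ.target ∧ θ.symm z ∈ φ.source :=
    (θ.open_target.eventually_mem h0θ).and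
      ((θ.symm.continuousAt h0θ).eventually_mem (by rw [hθ0]; exact φ.open_source.mem_nhds hx))
  have g3 : ∀ᶠ s : 𝔼 × ℝ in 𝓝 ((0 : 𝔼), (0 : ℝ)),
      θ (φ.symm s.1) - s.2 • b ∈ θ.target ∧ θ.symm (θ (φ.symm s.1) - s.2 • b) ∈ φ.source := by
    have : ContinuousAt (fun s : 𝔼 × ℝ => θ (φ.symm s.1) - s.2 • b) ((0 : 𝔼), (0 : ℝ)) :=
      (ContinuousAt.comp (f := Prod.fst) (x := ((0 : 𝔼), (0 : ℝ))) c1 continuousAt_fst).sub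
        (by fun_prop)
    refine this.eventually (p := fun y => y ∈ θ.target ∧ θ.symm y ∈ φ.source) ?_
    simpa [hφ0, hθx] using g2
  have g4 : ∀ᶠ s : 𝔼 × ℝ in 𝓝 ((0 : 𝔼), (0 : ℝ)), (s.1 ∈ φ.target ∧ φ.symm s.1 ∈ θ.source) ∧
      θ (φ.symm s.1) - s.2 • b ∈ θ.target ∧ θ.symm (θ (φ.symm s.1) - s.2 • b) ∈ φ.source :=
    (continuousAt_fst.eventually g1).and g3
  obtain ⟨ε, hε, hball⟩ : ∃ ε : ℝ, 0 < ε ∧ ∀ a : EuclideanSpace ℝ (Fin k), ‖a‖ ≤ 1 →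
      ((J (ε • a) ∈ φ.target ∧ φ.symm (J (ε • a)) ∈ θ.source) ∧
      θ (φ.symm (J (ε • a))) - (ε * (1 - ‖a‖)) • b ∈ θ.target ∧
      θ.symm (θ (φ.symm (J (ε • a))) - (ε * (1 - ‖a‖)) • b) ∈ φ.source) := by
    have hJ' : ContinuousAt (fun s : EuclideanSpace ℝ (Fin k) × ℝ => (J s.1, s.2)) (0, 0) := by
      fun_prop
    have g5 := hJ'.eventually (p := fun s : 𝔼 × ℝ => (s.1 ∈ φ.target ∧ φ.symm s.1 ∈ θ.source) ∧
      θ (φ.symm s.1) - s.2 • b ∈ θ.target ∧ θ.symm (θ (φ.symm s.1) - s.2 • b) ∈ φ.source)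
      (by simpa only [hJ0] using g4)
    obtain ⟨δ, hδ, hδ'⟩ := Metric.eventually_nhds_iff.mp g5
    refine ⟨δ / 2, by positivity, fun a ha => ?_⟩
    refine hδ' (y := ((δ / 2) • a, δ / 2 * (1 - ‖a‖))) ?_
    rw [Prod.dist_eq, max_lt_iff, dist_zero_right, dist_zero_right, norm_smul,
      Real.norm_of_nonneg (by positivity : 0 ≤ δ / 2),
      Real.norm_of_nonneg (mul_nonneg (by positivity) (by linarith))]
    constructor <;> nlinarith [norm_nonneg a]
  -- The descending disc of radius ε is pushed down in the regular chart by ε(1 − ‖a‖), hence not at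
  -- all on its boundary. F reads off its descending coordinates; a zero of F is a point where h ≥
  -- h(x), although the push made h < h(x) in the interior.
  let K : EuclideanSpace ℝ (Fin k) → 𝔼 := fun a =>
    θ (φ.symm (J (ε • a))) - (ε * (1 - ‖a‖)) • b
  let F : EuclideanSpace ℝ (Fin k) → EuclideanSpace ℝ (Fin k) := fun a =>
    ε⁻¹ • q (φ (θ.symm (K a)))
  have hKc : ContinuousOn K (closedBall 0 1) := by
    refine ContinuousOn.sub ?_ (by fun_prop)
    refine θ.continuousOn.comp (φ.symm.continuousOn.comp (t := φ.target) (by fun_prop) ?_) ?_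
    · intro a ha; exact (hball a (by simpa using ha)).1.1
    · intro a ha; exact (hball a (by simpa using ha)).1.2
  have hFc : ContinuousOn F (closedBall 0 1) := by
    have hs : Continuous fun z : 𝔼 => ε⁻¹ • q z := by fun_prop
    refine hs.comp_continuousOn ?_
    refine φ.continuousOn.comp (θ.symm.continuousOn.comp (t := θ.target) hKc ?_) ?_
    · intro a ha; exact (hball a (by simpa using ha)).2.1
    · intro a ha; exact (hball a (by simpa using ha)).2.2
  obtain ⟨a, ha, hFa⟩ := exists_zero_of_eqOn_sphere hFc (by
    intro a ha
    have hb1 := hball a ha.le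
    simp only [F, K, ha, sub_self, mul_zero, zero_smul, sub_zero]
    rw [θ.left_inv hb1.1.2, φ.right_inv hb1.1.1, hqJ, smul_smul, inv_mul_cancel₀ hε.ne', one_smul])
  obtain ⟨⟨hb1, hb2⟩, hb3, hb4⟩ := hball a ha
  replace hb4 : θ.symm (K a) ∈ φ.source := hb4
  have hqa : q (φ (θ.symm (K a))) = 0 := by
    simpa [F, hε.ne'] using hFa
  have hge : h x ≤ h (θ.symm (K a)) := by
    rw [hφ _ hb4]
    refine le_add_of_nonneg_right (Finset.sum_nonneg fun j _ => ?_)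
    by_cases hj : (j : ℕ) < k
    · have : φ (θ.symm (K a)) j = 0 := by
        have := congrArg (fun u : EuclideanSpace ℝ (Fin k) => u ⟨j, hj⟩) hqa
        simpa [q] using this
      simp only [hj, if_true, this]; simp
    · simp only [hj, if_false]; positivity
  have hle1 : h (θ.symm (K a)) = h x + θ (φ.symm (J (ε • a))) i - ε * (1 - ‖a‖) := by
    rw [hθ _ (θ.map_target hb3), θ.right_inv hb3]
    simp [hbi]; ring
  have hle2 : h x + θ (φ.symm (J (ε • a))) i =
      h x + ∑ j : Fin n, (if (j : ℕ) < k then -(J (ε • a) j) ^ 2 else (J (ε • a) j) ^ 2) := by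
    rw [← hθ _ hb2, hφ _ (φ.map_target hb1), φ.right_inv hb1]
  have hq2 := hquad (ε • a)
  rcases ha.lt_or_eq with hlt | heq
  · have := mul_pos hε (sub_pos.mpr hlt)
    linarith
  · have : F a = a := by
      simp only [F, K, heq, sub_self, mul_zero, zero_smul, sub_zero]
      rw [θ.left_inv hb2, φ.right_inv hb1, hqJ, smul_smul, inv_mul_cancel₀ hε.ne', one_smul]
    rw [hFa] at this
    rw [← this, norm_zero] at heq
    exact zero_ne_one heq

end Regularity

/-! ### Positive linear relations in finite families -/

section PositiveRelation

variable {ι E : Type*} [NormedAddCommGroup E] [InnerProductSpace ℝ E]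

lemma mem_convexHull_image_finset {V : Type*} [AddCommGroup V] [Module ℝ V] {B : Finset ι}
    {u : ι → V} {x : V} :
    x ∈ convexHull ℝ (u '' B) ↔
      ∃ l : ι → ℝ, (∀ i ∈ B, 0 ≤ l i) ∧ ∑ i ∈ B, l i = 1 ∧ ∑ i ∈ B, l i • u i = x := by
  classical
  constructor
  · intro hx
    refine convexHull_min (t := {x | ∃ l : ι → ℝ, (∀ i ∈ B, 0 ≤ l i) ∧ ∑ i ∈ B, l i = 1 ∧
      ∑ i ∈ B, l i • u i = x}) ?_ ?_ hx
    · rintro _ ⟨i, hi, rfl⟩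
      have hi' : i ∈ B := hi
      refine ⟨Pi.single i 1, fun j _ => ?_, ?_, ?_⟩
      · by_cases h : j = i
        · subst h; simp
        · simp [Pi.single_eq_of_ne h]
      · simp [Finset.sum_pi_single', hi']
      · rw [Finset.sum_eq_single_of_mem i hi' fun j _ hj => by simp [Pi.single_eq_of_ne hj]]
        simp
    · rintro _ ⟨l, hl0, hl1, rfl⟩ _ ⟨m, hm0, hm1, rfl⟩ a b ha hb hab
      refine ⟨fun i => a * l i + b * m i, fun i hi => ?_, ?_, ?_⟩
      · exact add_nonneg (mul_nonneg ha (hl0 i hi)) (mul_nonneg hb (hm0 i hi))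
      · rw [Finset.sum_add_distrib, ← Finset.mul_sum, ← Finset.mul_sum, hl1, hm1]; simpa using hab
      · simp only [add_smul, mul_smul, Finset.sum_add_distrib, Finset.smul_sum]
  · rintro ⟨l, hl0, hl1, rfl⟩
    exact (convex_convexHull ℝ _).sum_mem hl0 hl1
      fun i hi => subset_convexHull ℝ _ ⟨i, hi, rfl⟩

/-- The vectors `v i`, `i ∈ F`, satisfy a linear relation with positive coefficients. -/
def HasPositiveRelation (v : ι → E) (F : Finset ι) : Prop :=
  ∃ μ : ι → ℝ, (∀ i ∈ F, 0 < μ i) ∧ ∑ i ∈ F, μ i • v i = 0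

/-- Pairing the relation with y gives a vanishing sum of nonpositive terms if the claim fails; then
y is orthogonal to the span containing it. -/
lemma HasPositiveRelation.exists_inner_pos {v : ι → E} {F : Finset ι}
    (h : HasPositiveRelation v F) {y : E} (hy : y ∈ Submodule.span ℝ (v '' F)) (hy0 : y ≠ 0) :
    ∃ i ∈ F, 0 < ⟪y, v i⟫ := by
  obtain ⟨μ, hμ, hsum⟩ := h
  by_contra! hcon
  have h0 : ∑ i ∈ F, μ i * ⟪y, v i⟫ = 0 := by
    have := congrArg (fun u => ⟪y, u⟫) hsum
    simpa [inner_sum, inner_smul_right] using this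
  have h1 : ∀ i ∈ F, μ i * ⟪y, v i⟫ = 0 :=
    (Finset.sum_eq_zero_iff_of_nonpos fun i hi =>
      mul_nonpos_of_nonneg_of_nonpos (hμ i hi).le (hcon i hi)).mp h0
  have h2 : Submodule.span ℝ (v '' F) ≤ (ℝ ∙ y)ᗮ := by
    rw [Submodule.span_le]
    rintro _ ⟨i, hi, rfl⟩
    rw [SetLike.mem_coe, Submodule.mem_orthogonal_singleton_iff_inner_right]
    exact (mul_eq_zero.mp (h1 i hi)).resolve_left (hμ i hi).ne'
  have h3 := h2 hy
  rw [Submodule.mem_orthogonal_singleton_iff_inner_right] at h3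
  exact hy0 (inner_self_eq_zero.mp h3)

/-- On the span of the `v i`, the support function of a positively related family is coercive. -/
lemma HasPositiveRelation.exists_coercive [FiniteDimensional ℝ E] {v : ι → E} {F : Finset ι}
    (h : HasPositiveRelation v F) :
    ∃ c : ℝ, 0 < c ∧ ∀ y ∈ Submodule.span ℝ (v '' F), y ≠ 0 → ∃ i ∈ F, c * ‖y‖ ≤ ⟪y, v i⟫ := by
  set W := Submodule.span ℝ (v '' (F : Set ι)) with hW
  rcases (sphere (0 : W) 1).eq_empty_or_nonempty with hS | hS
  · refine ⟨1, one_pos, fun y hy hy0 => ?_⟩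
    exfalso
    have : (‖y‖⁻¹ • (⟨y, hy⟩ : W)) ∈ sphere (0 : W) 1 := by
      simp [norm_smul, hy0]
    rw [hS] at this
    exact this
  · have hF : F.Nonempty := by
      obtain ⟨y, hy⟩ := hS
      obtain ⟨i, hi, -⟩ := h.exists_inner_pos y.2 (by
        rintro h0
        rw [mem_sphere_zero_iff_norm, show y = 0 from Subtype.ext h0] at hy
        simp at hy)
      exact ⟨i, hi⟩
    have hc : Continuous fun y : W => F.sup' hF fun i => ⟪(y : E), v i⟫ :=
      Continuous.finset_sup'_apply hF fun i _ => by fun_prop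
    obtain ⟨y₀, hy₀, hmin⟩ := (isCompact_sphere (0 : W) 1).exists_isMinOn hS hc.continuousOn
    refine ⟨F.sup' hF fun i => ⟪(y₀ : E), v i⟫, ?_, fun y hy hy0 => ?_⟩
    · obtain ⟨i, hi, hpos⟩ := h.exists_inner_pos y₀.2 (by
        rintro h0
        rw [mem_sphere_zero_iff_norm, show y₀ = 0 from Subtype.ext h0] at hy₀
        simp at hy₀)
      exact hpos.trans_le (Finset.le_sup' (fun i => ⟪(y₀ : E), v i⟫) hi)
    · have hyn : 0 < ‖y‖ := norm_pos_iff.mpr hy0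
      have hmem : (‖y‖⁻¹ • (⟨y, hy⟩ : W)) ∈ sphere (0 : W) 1 := by
        simp [norm_smul, hy0]
      have h1 := hmin hmem
      obtain ⟨i, hi, hie⟩ := F.exists_mem_eq_sup' hF
        fun i => ⟪((‖y‖⁻¹ • (⟨y, hy⟩ : W) : W) : E), v i⟫
      refine ⟨i, hi, ?_⟩
      simp only [mem_ofPred_eq] at h1
      rw [hie] at h1
      simp only [Submodule.coe_smul, inner_smul_left, RCLike.conj_to_real] at h1
      rwa [le_inv_mul_iff₀ hyn, mul_comm] at h1

/-- Every finite family has a part carrying a positive relation such that the remaining vectors lie,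
modulo the span of that part, strictly on one side of a hyperplane. -/
lemma exists_maximal_positive_part [DecidableEq ι] [FiniteDimensional ℝ E] (v : ι → E) (A : Finset ι) :
    ∃ F ⊆ A, HasPositiveRelation v F ∧ (F = A ∨
      ∃ (e : E) (l : ι → ℝ), e ≠ 0 ∧ e ∈ (Submodule.span ℝ (v '' F))ᗮ ∧
        (∀ i ∈ A, i ∉ F → 0 ≤ l i) ∧ (∑ i ∈ A with i ∉ F, l i = 1) ∧
        (∑ i ∈ A with i ∉ F, l i • v i) - e ∈ Submodule.span ℝ (v '' F) ∧
        ∀ i ∈ A, i ∉ F → ‖e‖ ^ 2 ≤ ⟪e, v i⟫) := by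
  classical
  -- The empty family is trivially positively related, so a part of largest cardinality exists. The
  -- vector e will be the point of least norm in the hull of the remaining vectors projected to Wᗮ.
  obtain ⟨F, hF, hmax⟩ := (A.powerset.filter (HasPositiveRelation v)).exists_max_image Finset.card
    ⟨∅, by simp [HasPositiveRelation]⟩
  simp only [Finset.mem_filter, Finset.mem_powerset] at hF hmax
  refine ⟨F, hF.1, hF.2, ?_⟩
  by_cases hFA : F = A
  · exact Or.inl hFA
  right
  set W := Submodule.span ℝ (v '' (F : Set ι)) with hW
  let B : Finset ι := A.filter fun i => i ∉ F
  have hB : B.Nonempty := by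
    obtain ⟨i, hiA, hiF⟩ := Finset.exists_of_ssubset (hF.1.ssubset_of_ne hFA)
    exact ⟨i, by simp [B, hiA, hiF]⟩
  let u : ι → E := fun i => v i - W.starProjection (v i)
  have huW : ∀ i, u i ∈ Wᗮ := fun i => Submodule.sub_starProjection_mem_orthogonal _
  let C : Set E := convexHull ℝ (u '' B)
  have hCne : C.Nonempty := ((Finset.coe_nonempty.mpr hB).image u).convexHull
  have hCc : IsCompact C := (B.finite_toSet.image u).isCompact_convexHull ℝ
  obtain ⟨e, heC, he⟩ := exists_norm_eq_iInf_of_complete_convex hCne hCc.isComplete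
    (convex_convexHull ℝ _) 0
  have hinner := (norm_eq_iInf_iff_real_inner_le_zero (convex_convexHull ℝ _) heC).mp he
  have hCW : C ⊆ Wᗮ := convexHull_min (by rintro _ ⟨i, -, rfl⟩; exact huW i)
    (show Convex ℝ (Wᗮ : Set E) from Submodule.convex _)
  obtain ⟨l, hl0, hl1, hle⟩ : ∃ l : ι → ℝ, (∀ i ∈ B, 0 ≤ l i) ∧ ∑ i ∈ B, l i = 1 ∧
      ∑ i ∈ B, l i • u i = e :=
    mem_convexHull_image_finset.mp heC
  have hmod : (∑ i ∈ B, l i • v i) - e ∈ W := by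
    rw [← hle, ← Finset.sum_sub_distrib]
    refine W.sum_mem fun i _ => ?_
    rw [← smul_sub]
    refine W.smul_mem _ ?_
    simp only [u, sub_sub_cancel]
    exact Submodule.starProjection_apply_mem W _
  refine ⟨e, l, ?_, hCW heC, fun i hiA hiF => hl0 i (by simp [B, hiA, hiF]), hl1, hmod, ?_⟩
  · rintro rfl
    rw [sub_zero] at hmod
    obtain ⟨a, ha⟩ : ∃ a : ι → ℝ, ∑ i ∈ B, l i • v i = ∑ i ∈ F, a i • v i := by
      obtain ⟨a, ha⟩ := (Submodule.mem_span_image_finset_iff_exists_fun' ℝ).mp hmod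
      exact ⟨a, ha.symm⟩
    obtain ⟨μ, hμ, hμ0⟩ := hF.2
    -- If e = 0, a convex combination of the remaining vectors lies in W. Adding a large multiple M
    -- of the relation on F makes all coefficients on F positive, so F could be enlarged by the
    -- indices of positive weight.
    obtain ⟨M, hM⟩ : ∃ M : ℝ, ∀ i ∈ F, a i < M * μ i := by
      refine ⟨∑ i ∈ F, |a i| / μ i + 1, fun i hi => ?_⟩
      have h1 : |a i| / μ i ≤ ∑ j ∈ F, |a j| / μ j :=
        Finset.single_le_sum (f := fun j => |a j| / μ j)
          (fun j hj => div_nonneg (abs_nonneg _) (hμ j hj).le) hi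
      rw [← div_lt_iff₀ (hμ i hi)]
      have := div_le_div_of_nonneg_right (le_abs_self (a i)) (hμ i hi).le
      linarith
    let D : Finset ι := B.filter fun i => 0 < l i
    have hDne : D.Nonempty := by
      by_contra hD
      have : ∑ i ∈ B, l i ≤ 0 := Finset.sum_nonpos fun i hi => by
        by_contra hpos
        exact hD ⟨i, by simp only [D, Finset.mem_filter]; exact ⟨hi, not_le.mp hpos⟩⟩
      linarith
    have hdisj : Disjoint F D := by
      rw [Finset.disjoint_left]
      intro i hi hiD
      simp only [D, B, Finset.mem_filter] at hiD
      exact hiD.1.2 hi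
    have hrel : HasPositiveRelation v (F ∪ D) := by
      refine ⟨fun i => if i ∈ F then M * μ i - a i else l i, fun i hi => ?_, ?_⟩
      · by_cases hiF : i ∈ F
        · simp only [hiF, if_true]; linarith [hM i hiF]
        · simp only [hiF, if_false]
          have := (Finset.mem_union.mp hi).resolve_left hiF
          exact (Finset.mem_filter.mp this).2
      · rw [Finset.sum_union hdisj]
        have e1 : ∑ i ∈ F, (if i ∈ F then M * μ i - a i else l i) • v i =
            - ∑ i ∈ F, a i • v i := by
          rw [Finset.sum_congr rfl fun i hi => by rw [if_pos hi, sub_smul, mul_smul],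
            Finset.sum_sub_distrib, ← Finset.smul_sum, hμ0, smul_zero, zero_sub]
        have e2 : ∑ i ∈ D, (if i ∈ F then M * μ i - a i else l i) • v i = ∑ i ∈ B, l i • v i := by
          rw [Finset.sum_congr rfl fun i hi => by
            rw [if_neg fun hiF => (Finset.disjoint_left.mp hdisj) hiF hi]]
          refine Finset.sum_subset (Finset.filter_subset _ _) fun i hi hiD => ?_
          have : l i = 0 := le_antisymm
            (not_lt.mp fun hpos => hiD (Finset.mem_filter.mpr ⟨hi, hpos⟩)) (hl0 i hi)
          rw [this, zero_smul]
        rw [e1, e2, ha, neg_add_cancel]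
    have hsub : F ∪ D ⊆ A := Finset.union_subset hF.1
      ((Finset.filter_subset _ _).trans (Finset.filter_subset _ _))
    have := hmax _ ⟨hsub, hrel⟩
    rw [Finset.card_union_of_disjoint hdisj] at this
    have := hDne.card_pos
    omega
  · intro i hiA hiF
    have h1 := hinner (u i) (subset_convexHull ℝ _ ⟨i, by simp [B, hiA, hiF], rfl⟩)
    rw [zero_sub, inner_neg_left, inner_sub_right, real_inner_self_eq_norm_sq] at h1
    have h2 : ⟪e, v i⟫ = ⟪e, u i⟫ := by
      simp only [u, inner_sub_right]
      rw [Submodule.inner_left_of_mem_orthogonal (Submodule.starProjection_apply_mem W (v i))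
        (hCW heC), sub_zero]
    linarith

end PositiveRelation

/-! ### Descent of the local model without a positive relation -/

section LocalModel

variable {ι E : Type*} [NormedAddCommGroup E] [InnerProductSpace ℝ E]

/-- The local form `½ |h|² - max_{i ∈ A} ⟨h, v i⟩` of a minimum of quadratic functions. -/
noncomputable def localModel (A : Finset ι) (hA : A.Nonempty) (v : ι → E) (h : E) : ℝ :=
  (1 / 2) * ‖h‖ ^ 2 - A.sup' hA fun i => ⟪h, v i⟫

lemma continuous_localModel (A : Finset ι) (hA : A.Nonempty) (v : ι → E) :
    Continuous (localModel A hA v) := by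
  have : Continuous fun h : E => A.sup' hA fun i => ⟪h, v i⟫ :=
    Continuous.finset_sup'_apply hA fun i _ => by fun_prop
  unfold localModel
  fun_prop

/-- An index attaining the maximum at h bounds the maximum at h + tX from below, so the decrease can
be checked on that single index. -/
lemma localModel_add_smul_lt {A : Finset ι} (hA : A.Nonempty) {v : ι → E} {i : ι} (hi : i ∈ A)
    {h X : E} (hmax : ∀ j ∈ A, ⟪h, v j⟫ ≤ ⟪h, v i⟫) {t : ℝ} (ht : 0 < t)
    (hlt : ⟪X, h⟫ + ⟪X, h + t • X⟫ < 2 * ⟪X, v i⟫) :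
    localModel A hA v (h + t • X) < localModel A hA v h := by
  have h1 : A.sup' hA (fun j => ⟪h, v j⟫) ≤ ⟪h, v i⟫ := Finset.sup'_le hA _ hmax
  have h2 : ⟪h + t • X, v i⟫ ≤ A.sup' hA fun j => ⟪h + t • X, v j⟫ :=
    Finset.le_sup' (fun j => ⟪h + t • X, v j⟫) hi
  have h3 : ‖h + t • X‖ ^ 2 = ‖h‖ ^ 2 + t * (⟪X, h⟫ + ⟪X, h + t • X⟫) := by
    rw [norm_add_sq_real, inner_add_right, real_inner_smul_right, real_inner_smul_right,
      real_inner_self_eq_norm_sq, norm_smul, mul_pow, Real.norm_eq_abs, sq_abs, real_inner_comm]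
    ring
  rw [inner_add_left, real_inner_smul_left] at h2
  have h4 := mul_lt_mul_of_pos_left hlt ht
  simp only [localModel]
  rw [h3]
  linarith

/-- If the vectors `v i`, `i ∈ A`, are not positively related, the local model is strictly
decreasing along a pencil of lines. -/
lemma exists_localModel_strictAnti [DecidableEq ι] [FiniteDimensional ℝ E] {A : Finset ι}
    (hA : A.Nonempty) (v : ι → E) {F : Finset ι} (hFA : F ⊆ A) (hF : HasPositiveRelation v F)
    {e : E} {l : ι → ℝ} (he : e ≠ 0) (heW : e ∈ (Submodule.span ℝ (v '' F))ᗮ)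
    (hl0 : ∀ i ∈ A, i ∉ F → 0 ≤ l i) (hl1 : ∑ i ∈ A with i ∉ F, l i = 1)
    (hle : (∑ i ∈ A with i ∉ F, l i • v i) - e ∈ Submodule.span ℝ (v '' F))
    (hev : ∀ i ∈ A, i ∉ F → ‖e‖ ^ 2 ≤ ⟪e, v i⟫) :
    ∃ b r : ℝ, 0 < b ∧ 0 < r ∧ b * r ≤ 1 / 2 ∧ ∀ w ∈ Submodule.span ℝ (v '' F),
      ∀ p ∈ (Submodule.span ℝ (v '' F))ᗮ, ⟪p, e⟫ = 0 → ‖w‖ < r → ∀ t₁ t₂, -r < t₁ → t₁ < t₂ →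
        t₂ < r → localModel A hA v ((1 + b * t₂) • w + p + t₂ • e) <
          localModel A hA v ((1 + b * t₁) • w + p + t₁ • e) := by
  set W := Submodule.span ℝ (v '' (F : Set ι)) with hW
  obtain ⟨c, hc, hcoer⟩ := hF.exists_coercive
  obtain ⟨C, hC1, hC⟩ : ∃ C : ℝ, 1 ≤ C ∧ ∀ i ∈ A, ‖v i‖ ≤ C := by
    refine ⟨∑ i ∈ A, ‖v i‖ + 1, ?_, fun i hi => ?_⟩
    · linarith [Finset.sum_nonneg fun i (_ : i ∈ A) => norm_nonneg (v i)]
    · linarith [Finset.single_le_sum (f := fun i => ‖v i‖) (fun j _ => norm_nonneg (v j)) hi]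
  set Q := ‖e‖ ^ 2 with hQ
  have hQpos : 0 < Q := by have := norm_pos_iff.mpr he; positivity
  set b : ℝ := 16 * C / c with hb
  have hbpos : 0 < b := by positivity
  have hbc : b * c = 16 * C := by rw [hb]; field_simp
  set K : ℝ := 4 * C / Q with hK
  have hKQ : K * Q = 4 * C := by rw [hK]; field_simp
  obtain ⟨r, hr, hr1, hr2, hr3, hr4⟩ : ∃ r : ℝ, 0 < r ∧ r ≤ 1 / 4 ∧ b * r ≤ 1 / 2 ∧
      b * r * C ≤ Q / 4 ∧ 2 * (b * r) ≤ Q := by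
    refine ⟨min (1 / 4) (min (1 / 2 / b) (min (Q / 4 / (b * C)) (Q / 2 / b))), by positivity,
      min_le_left _ _, ?_, ?_, ?_⟩
    · rw [mul_comm, ← le_div_iff₀ hbpos]
      exact (min_le_right _ _).trans (min_le_left _ _)
    · rw [mul_right_comm, mul_comm, ← le_div_iff₀ (by positivity)]
      exact (min_le_right _ _).trans ((min_le_right _ _).trans (min_le_left _ _))
    · have : min (1 / 4) (min (1 / 2 / b) (min (Q / 4 / (b * C)) (Q / 2 / b))) ≤ Q / 2 / b :=
        (min_le_right _ _).trans ((min_le_right _ _).trans (min_le_right _ _))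
      rw [le_div_iff₀ hbpos] at this
      linarith
  refine ⟨b, r, hbpos, hr, hr2, fun w hw p hp hpe hwr => ?_⟩
  have hwp : ⟪w, p⟫ = 0 := Submodule.inner_right_of_mem_orthogonal hw hp
  have hwe : ⟪w, e⟫ = 0 := Submodule.inner_right_of_mem_orthogonal hw heW
  have hvW : ∀ i ∈ F, v i ∈ W := fun i hi => Submodule.subset_span ⟨i, hi, rfl⟩
  have hwn := norm_nonneg w
  set X : E := b • w + e with hX
  let h : ℝ → E := fun t => (1 + b * t) • w + p + t • e
  have hstep : ∀ t₁ t₂, h t₂ = h t₁ + (t₂ - t₁) • X := by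
    intro t₁ t₂; simp only [h, hX]; module
  have hXh : ∀ t, ⟪X, h t⟫ = b * (1 + b * t) * ‖w‖ ^ 2 + t * Q := by
    intro t
    have hew : ⟪e, w⟫ = 0 := by rw [real_inner_comm, hwe]
    have hep : ⟪e, p⟫ = 0 := by rw [real_inner_comm, hpe]
    simp only [hX, h, inner_add_left, inner_add_right, real_inner_smul_left, real_inner_smul_right,
      hwp, hwe, hew, hep, real_inner_self_eq_norm_sq]
    ring
  have hhF : ∀ t, ∀ i ∈ F, ⟪h t, v i⟫ = (1 + b * t) * ⟪w, v i⟫ := by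
    intro t i hi
    simp only [h, inner_add_left, real_inner_smul_left]
    rw [Submodule.inner_left_of_mem_orthogonal (hvW i hi) hp,
      Submodule.inner_left_of_mem_orthogonal (hvW i hi) heW]
    ring
  have hbt : ∀ t, -r < t → t < r → 1 / 2 ≤ 1 + b * t ∧ 1 + b * t ≤ 2 := by
    intro t h1 h2
    constructor <;> nlinarith
  have hwv : ∀ i ∈ A, |⟪w, v i⟫| ≤ C * ‖w‖ := fun i hi =>
    (abs_real_inner_le_norm _ _).trans (by nlinarith [hC i hi])
  -- descent along an active index outside `F`
  have hout : ∀ t₁ t₂, -r < t₁ → t₁ < t₂ → t₂ < r → ∀ i ∈ A, i ∉ F →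
      (∀ j ∈ A, ⟪h t₁, v j⟫ ≤ ⟪h t₁, v i⟫) →
      localModel A hA v (h t₂) < localModel A hA v (h t₁) := by
    intro t₁ t₂ h1 h12 h2 i hi hiF hmax
    rw [hstep t₁ t₂]
    refine localModel_add_smul_lt hA hi hmax (sub_pos.mpr h12) ?_
    rw [← hstep t₁ t₂, hXh, hXh]
    have e1 : Q - b * (C * ‖w‖) ≤ ⟪X, v i⟫ := by
      simp only [hX, inner_add_left, real_inner_smul_left]
      have := hev i hi hiF
      have := mul_le_mul_of_nonneg_left (neg_le_of_abs_le (hwv i hi)) hbpos.le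
      linarith
    have e2 : ∀ t, -r < t → t < r → b * (1 + b * t) * ‖w‖ ^ 2 ≤ Q / 4 := by
      intro t ht1 ht2
      have hb2 := (hbt t ht1 ht2).2
      have hb1 := (hbt t ht1 ht2).1
      calc b * (1 + b * t) * ‖w‖ ^ 2 ≤ b * 2 * (r * (1 / 4)) := by
            rw [sq]; gcongr; linarith
        _ ≤ Q / 4 := by linarith
    have e3 : ∀ t, t < r → t * Q ≤ Q / 4 := by intro t ht; nlinarith
    have e4 : b * (C * ‖w‖) < Q / 4 := by
      have : b * C * ‖w‖ < b * C * r := mul_lt_mul_of_pos_left hwr (by positivity)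
      linarith
    linarith [e2 t₁ h1 (h12.trans h2), e2 t₂ (h1.trans h12) h2, e3 t₁ (h12.trans h2), e3 t₂ h2]
  -- Indices of F contribute at most 2C‖w‖ at h t₁, while the convex combination m of outside
  -- vectors contributes at least −2C‖w‖ + t₁Q ≥ 2C‖w‖. Hence the best outside index attains the
  -- overall maximum.
  have hupper : ∀ t₁ t₂, -r < t₁ → t₁ < t₂ → t₂ < r → K * ‖w‖ ≤ t₁ →
      localModel A hA v (h t₂) < localModel A hA v (h t₁) := by
    intro t₁ t₂ h1 h12 h2 hKt
    have hB : (A.filter fun i => i ∉ F).Nonempty := by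
      by_contra hB
      rw [Finset.not_nonempty_iff_eq_empty] at hB
      rw [hB] at hl1
      simp at hl1
    obtain ⟨i, hiB, himax⟩ := Finset.exists_max_image _ (fun i => ⟪h t₁, v i⟫) hB
    obtain ⟨hiA, hiF⟩ := Finset.mem_filter.mp hiB
    refine hout t₁ t₂ h1 h12 h2 i hiA hiF fun j hj => ?_
    by_cases hjF : j ∈ F
    · have hb1 := hbt t₁ h1 (h12.trans h2)
      have f1 : ⟪h t₁, v j⟫ ≤ 2 * (C * ‖w‖) := by
        rw [hhF t₁ j hjF]
        have := le_of_abs_le (hwv j hj)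
        have : (1 + b * t₁) * ⟪w, v j⟫ ≤ (1 + b * t₁) * (C * ‖w‖) :=
          mul_le_mul_of_nonneg_left this (by linarith)
        have : (1 + b * t₁) * (C * ‖w‖) ≤ 2 * (C * ‖w‖) :=
          mul_le_mul_of_nonneg_right hb1.2 (by positivity)
        linarith
      set m := ∑ i ∈ A with i ∉ F, l i • v i with hm
      have f2 : ⟪h t₁, m⟫ ≤ ⟪h t₁, v i⟫ := by
        rw [hm, inner_sum]
        simp only [real_inner_smul_right]
        calc ∑ i ∈ A with i ∉ F, l i * ⟪h t₁, v i⟫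
            ≤ ∑ k ∈ A with k ∉ F, l k * ⟪h t₁, v i⟫ := Finset.sum_le_sum fun k hk =>
              mul_le_mul_of_nonneg_left (himax k hk)
                (hl0 k (Finset.mem_filter.mp hk).1 (Finset.mem_filter.mp hk).2)
          _ = ⟪h t₁, v i⟫ := by rw [← Finset.sum_mul, hl1, one_mul]
      have f3 : ⟪h t₁, m⟫ = (1 + b * t₁) * ⟪w, m⟫ + t₁ * Q := by
        have g1 : ⟪p, m⟫ = 0 := by
          have := Submodule.inner_left_of_mem_orthogonal hle hp
          rwa [inner_sub_right, hpe, sub_zero] at this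
        have g2 : ⟪e, m⟫ = Q := by
          have := Submodule.inner_left_of_mem_orthogonal hle heW
          rw [inner_sub_right, real_inner_self_eq_norm_sq] at this
          linarith
        simp only [h, inner_add_left, real_inner_smul_left, g1, g2]
        ring
      have f4 : -(C * ‖w‖) ≤ ⟪w, m⟫ := by
        rw [hm, inner_sum]
        simp only [real_inner_smul_right]
        calc -(C * ‖w‖) = ∑ k ∈ A with k ∉ F, l k * -(C * ‖w‖) := by
              rw [← Finset.sum_mul, hl1, one_mul]
          _ ≤ _ := Finset.sum_le_sum fun k hk => mul_le_mul_of_nonneg_left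
                (neg_le_of_abs_le (hwv k (Finset.mem_filter.mp hk).1))
                (hl0 k (Finset.mem_filter.mp hk).1 (Finset.mem_filter.mp hk).2)
      have f5 : 4 * C * ‖w‖ ≤ t₁ * Q := by
        have := mul_le_mul_of_nonneg_right hKt hQpos.le
        calc 4 * C * ‖w‖ = K * ‖w‖ * Q := by rw [← hKQ]; ring
          _ ≤ _ := this
      have f6 : (1 + b * t₁) * -(C * ‖w‖) ≤ (1 + b * t₁) * ⟪w, m⟫ :=
        mul_le_mul_of_nonneg_left f4 (by linarith)
      have f7 : (1 + b * t₁) * (C * ‖w‖) ≤ 2 * (C * ‖w‖) :=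
          mul_le_mul_of_nonneg_right hb1.2 (by positivity)
      linarith
    · exact himax j (Finset.mem_filter.mpr ⟨hj, hjF⟩)
  have hlower : ∀ t₁ t₂, -r < t₁ → t₁ < t₂ → t₂ < r → t₂ ≤ K * ‖w‖ →
      localModel A hA v (h t₂) < localModel A hA v (h t₁) := by
    intro t₁ t₂ h1 h12 h2 hKt
    obtain ⟨i, hiA, himax⟩ := Finset.exists_max_image _ (fun i => ⟪h t₁, v i⟫) hA
    by_cases hiF : i ∈ F
    swap
    · exact hout t₁ t₂ h1 h12 h2 i hiA hiF himax
    rw [hstep t₁ t₂]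
    refine localModel_add_smul_lt hA hiA himax (sub_pos.mpr h12) ?_
    rw [← hstep t₁ t₂, hXh, hXh]
    have e1 : ⟪X, v i⟫ = b * ⟪w, v i⟫ := by
      simp only [hX, inner_add_left, real_inner_smul_left]
      rw [Submodule.inner_left_of_mem_orthogonal (hvW i hiF) heW, add_zero]
    rw [e1]
    -- For w = 0 the stretching gives nothing, but then t₁ < t₂ ≤ 0 and the quadratic term itself
    -- decreases.
    by_cases hw0 : w = 0
    · subst hw0
      simp only [norm_zero, mul_zero, inner_zero_left] at hKt ⊢
      have : t₂ * Q ≤ 0 := mul_nonpos_of_nonpos_of_nonneg hKt hQpos.le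
      have : t₁ * Q < 0 := mul_neg_of_neg_of_pos (by linarith) hQpos
      norm_num
      linarith
    · have hwpos : 0 < ‖w‖ := norm_pos_iff.mpr hw0
      obtain ⟨k, hkF, hk⟩ := hcoer w hw hw0
      have hb1 := hbt t₁ h1 (h12.trans h2)
      have f1 : c * ‖w‖ ≤ ⟪w, v i⟫ := by
        have := himax k (hFA hkF)
        rw [hhF t₁ k hkF, hhF t₁ i hiF] at this
        exact hk.trans (le_of_mul_le_mul_left this (by linarith))
      have f2 : ∀ t, -r < t → t < r → b * (1 + b * t) * ‖w‖ ^ 2 ≤ C * ‖w‖ := by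
        intro t ht1 ht2
        have hb2 := (hbt t ht1 ht2).2
        have hb1 := (hbt t ht1 ht2).1
        calc b * (1 + b * t) * ‖w‖ ^ 2 ≤ b * 2 * (r * ‖w‖) := by rw [sq]; gcongr
          _ = (2 * (b * r)) * ‖w‖ := by ring
          _ ≤ C * ‖w‖ := by gcongr; linarith
      have f3 : ∀ t, t ≤ K * ‖w‖ → t * Q ≤ 4 * C * ‖w‖ := by
        intro t ht
        calc t * Q ≤ K * ‖w‖ * Q := by gcongr
          _ = 4 * C * ‖w‖ := by rw [← hKQ]; ring
      have f4 : 16 * C * ‖w‖ ≤ b * ⟪w, v i⟫ := by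
        rw [← hbc, mul_assoc]; gcongr
      have f5 : 0 < C * ‖w‖ := by positivity
      linarith [f2 t₁ h1 (h12.trans h2), f2 t₂ (h1.trans h12) h2, f3 t₁ (h12.le.trans hKt),
        f3 t₂ hKt]
  intro t₁ t₂ h1 h12 h2
  rcases le_total (K * ‖w‖) t₁ with hcase | hcase
  · exact hupper t₁ t₂ h1 h12 h2 hcase
  rcases le_total t₂ (K * ‖w‖) with hcase2 | hcase2
  · exact hlower t₁ t₂ h1 h12 h2 hcase2
  rcases hcase.eq_or_lt with heq | hlt
  · exact hupper t₁ t₂ h1 h12 h2 heq.ge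
  rcases hcase2.eq_or_lt with heq | hlt2
  · exact hlower t₁ t₂ h1 h12 h2 heq.ge
  · exact (hupper _ t₂ (h1.trans hlt) hlt2 h2 le_rfl).trans
      (hlower t₁ _ h1 hlt (hlt2.trans h2) le_rfl)

end LocalModel

lemma isTopRegular_localModel {n : ℕ} {ι : Type*} [DecidableEq ι] {A : Finset ι} (hA : A.Nonempty)
    (v : ι → EuclideanSpace ℝ (Fin n)) (hrel : ¬ HasPositiveRelation v A) :
    IsTopRegular (localModel A hA v) 0 := by
  obtain ⟨F, hFA, hF, rfl | ⟨e, l, he, heW, hl0, hl1, hle, hev⟩⟩ :=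
    exists_maximal_positive_part v A
  · exact absurd hF hrel
  obtain ⟨b, r, hb, hr, hbr, hanti⟩ :=
    exists_localModel_strictAnti hA v hFA hF he heW hl0 hl1 hle hev
  set W := Submodule.span ℝ (v '' (F : Set ι)) with hW
  set Q := ‖e‖ ^ 2 with hQ
  have hen : 0 < ‖e‖ := norm_pos_iff.mpr he
  have hQpos : 0 < Q := by positivity
  let τ : EuclideanSpace ℝ (Fin n) → ℝ := fun h => inner ℝ h e / Q
  let pr : EuclideanSpace ℝ (Fin n) →L[ℝ] EuclideanSpace ℝ (Fin n) := W.starProjection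
  have hτc : Continuous τ := by fun_prop
  have hprW : ∀ h, pr h ∈ W := fun h => Submodule.starProjection_apply_mem W h
  have hτpr : ∀ h, inner ℝ (pr h) e = 0 := fun h =>
    Submodule.inner_right_of_mem_orthogonal (hprW h) heW
  have hprpr : ∀ h, pr (pr h) = pr h := fun h =>
    Submodule.starProjection_eq_self_iff.mpr (hprW h)
  have hτadd : ∀ h (s : ℝ), τ (h + s • pr h) = τ h := by
    intro h s; simp [τ, inner_add_left, real_inner_smul_left, hτpr]
  -- L multiplies the W-component by 1 + bτ and keeps τ, so it carries lines parallel to e to the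
  -- descent lines; L' divides by the same factor.
  let L : EuclideanSpace ℝ (Fin n) → EuclideanSpace ℝ (Fin n) := fun h => h + (b * τ h) • pr h
  let L' : EuclideanSpace ℝ (Fin n) → EuclideanSpace ℝ (Fin n) := fun h =>
    h + (-(b * τ h) / (1 + b * τ h)) • pr h
  let U : Set (EuclideanSpace ℝ (Fin n)) := {h | 1 + b * τ h ≠ 0}
  have hU : IsOpen U := isOpen_ne_fun (by fun_prop) continuous_const
  have hLc : Continuous L := by fun_prop
  have hL'c : ContinuousOn L' U := by
    refine continuousOn_id.add (ContinuousOn.smul (ContinuousOn.div ?_ ?_ fun h hh => hh) ?_) <;>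
      fun_prop
  obtain ⟨T, hTs, hT⟩ := exists_openPartialHomeomorph hU hU hLc.continuousOn hL'c
    (fun h hh _ => by
      have hh' : 1 + b * τ h ≠ 0 := hh
      simp only [L, L', hτadd, map_add, map_smul, hprpr, smul_add, smul_smul, add_assoc, ← add_smul]
      rw [add_eq_left]
      convert zero_smul ℝ _ using 2
      field_simp
      ring)
    (fun h hh _ => by
      have hh' : 1 + b * τ h ≠ 0 := hh
      simp only [L, L', hτadd, map_add, map_smul, hprpr, smul_add, smul_smul, add_assoc, ← add_smul]
      rw [add_eq_left]
      convert zero_smul ℝ _ using 2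
      field_simp
      ring)
  have hT0 : T 0 = 0 := by rw [hT]; simp [L]
  have h0 : (0 : EuclideanSpace ℝ (Fin n)) ∈ T.source := by
    rw [hTs]; simp [U, L, τ]
  rw [← hT0]
  refine IsTopRegular.of_comp (H := localModel A hA v ∘ L) T h0 (fun z _ => by rw [hT, zero_add]; rfl) ?_
  refine IsTopRegular.of_antitone_line ((continuous_localModel A hA v).comp hLc) he
    (r := min r (r * ‖e‖)) (by positivity) fun y t ht hy hyt => ?_
  have hτb : ∀ h : EuclideanSpace ℝ (Fin n), ‖h‖ < min r (r * ‖e‖) → |τ h| < r := by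
    intro h hh
    have h1 := abs_real_inner_le_norm h e
    simp only [τ, abs_div, abs_of_pos hQpos]
    rw [div_lt_iff₀ hQpos]
    have h2 := mul_lt_mul_of_pos_right (hh.trans_le (min_le_right _ _)) hen
    calc _ ≤ _ := h1
      _ < _ := h2
      _ = _ := by rw [hQ]; ring
  have hpre : pr e = 0 := (Submodule.starProjection_apply_eq_zero_iff _).mpr heW
  have hτt : τ (y + t • e) = τ y + t := by
    simp only [τ, inner_add_left, real_inner_smul_left, real_inner_self_eq_norm_sq]
    rw [← hQ]; field_simp
  have hprt : pr (y + t • e) = pr y := by simp [hpre]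
  have key : ∀ s : ℝ, y + (s - τ y) • e + (b * s) • pr y =
      (1 + b * s) • pr y + (y - pr y - τ y • e) + s • e := by intro s; module
  have := hanti (pr y) (hprW y) (y - pr y - τ y • e)
    (Wᗮ.sub_mem (Submodule.sub_starProjection_mem_orthogonal y) (Wᗮ.smul_mem _ heW))
    (by
      rw [inner_sub_left, inner_sub_left, hτpr, real_inner_smul_left, real_inner_self_eq_norm_sq]
      simp only [τ, ← hQ]; field_simp; ring)
    ((Submodule.norm_starProjection_apply_le W y).trans_lt (hy.trans_le (min_le_left _ _)))
    (τ y) (τ y + t) (abs_lt.mp (hτb y hy)).1 (by linarith)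
    (by rw [← hτt]; exact (abs_lt.mp (hτb _ hyt)).2)
  rw [← key, ← key] at this
  simpa [L, hτt, hprt] using this

/-! ### Morse charts from a positive relation -/

/-- This handles radial rescalings at zeros of u: the norm of the product is at most |a|, and
division by zero yields the limit value 0. -/
lemma continuousAt_div_norm_smul {X E : Type*} [TopologicalSpace X] [NormedAddCommGroup E]
    [NormedSpace ℝ E] {a : X → ℝ} {u : X → E} {x : X} (ha : ContinuousAt a x)
    (hu : ContinuousAt u x) (h0 : u x = 0 → a x = 0) :
    ContinuousAt (fun y => (a y / ‖u y‖) • u y) x := by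
  by_cases hx : u x = 0
  · have : Tendsto (fun y => (a y / ‖u y‖) • u y) (𝓝 x) (𝓝 0) := by
      refine squeeze_zero_norm (a := fun y => |a y|) (fun y => ?_) ?_
      · rw [norm_smul, norm_div, norm_norm, Real.norm_eq_abs]
        by_cases hy : u y = 0
        · simp [hy]
        · rw [div_mul_cancel₀ _ (norm_ne_zero_iff.mpr hy)]
      · have := ha.abs.tendsto
        rwa [h0 hx, abs_zero] at this
    simpa [ContinuousAt, hx] using this
  · exact (ha.div hu.norm (norm_ne_zero_iff.mpr hx)).smul hu

/-- Orthonormal coordinates adapted to a subspace. -/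
lemma exists_linearIsometryEquiv_adapted {n : ℕ} (V : Submodule ℝ (EuclideanSpace ℝ (Fin n))) :
    ∃ I : EuclideanSpace ℝ (Fin n) ≃ₗᵢ[ℝ] EuclideanSpace ℝ (Fin n), ∀ z,
      ∑ i : Fin n, (if (i : ℕ) < Module.finrank ℝ V then -(I z i) ^ 2 else (I z i) ^ 2) =
        ‖z - V.starProjection z‖ ^ 2 - ‖V.starProjection z‖ ^ 2 := by
  set k := Module.finrank ℝ V with hk
  have hkn : k ≤ n := by
    have := Submodule.finrank_le V
    rwa [finrank_euclideanSpace_fin] at this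
  let u := stdOrthonormalBasis ℝ V
  let v : Fin n → EuclideanSpace ℝ (Fin n) := fun i =>
    if h : (i : ℕ) < k then (u ⟨i, h⟩ : EuclideanSpace ℝ (Fin n)) else 0
  let s : Set (Fin n) := {i | (i : ℕ) < k}
  have hv : Orthonormal ℝ (s.domRestrict v) := by
    have hu : Orthonormal ℝ fun i => (u i : EuclideanSpace ℝ (Fin n)) :=
      u.orthonormal.comp_linearIsometry V.subtypeₗᵢ
    have hinj : Function.Injective fun i : s => (⟨(i : Fin n), i.2⟩ : Fin k) := by
      intro i j hij
      have := congrArg Fin.val hij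
      exact Subtype.ext (Fin.ext this)
    convert hu.comp _ hinj using 1
    ext1 i
    have hi : ((i : Fin n) : ℕ) < k := i.2
    simp [v, hi]
  obtain ⟨b, hb⟩ := hv.exists_orthonormalBasis_extension_of_card_eq (by simp)
  have hbV : ∀ i : Fin n, (i : ℕ) < k → b i ∈ V := by
    intro i hi
    rw [hb i hi]
    simp only [v, hi, dite_true]
    exact (u ⟨i, hi⟩).2
  -- The first k basis vectors already contain an orthonormal basis of V, so all the others are
  -- orthogonal to V.
  have hbV' : ∀ i : Fin n, ¬ (i : ℕ) < k → b i ∈ Vᗮ := by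
    intro i hi
    rw [Submodule.mem_orthogonal]
    intro y hy
    have hsum := congrArg (fun y : V => (y : EuclideanSpace ℝ (Fin n))) (u.sum_repr ⟨y, hy⟩)
    simp only [Submodule.coe_sum, Submodule.coe_smul] at hsum
    rw [← hsum, sum_inner]
    refine Finset.sum_eq_zero fun j _ => ?_
    have hj : ((Fin.castLE hkn j : Fin n) : ℕ) < k := j.2
    have h1 : (u j : EuclideanSpace ℝ (Fin n)) = b (Fin.castLE hkn j) := by
      rw [hb _ hj]; simp [v]
    rw [real_inner_smul_left, h1, b.orthonormal.2, mul_zero]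
    intro h
    exact hi (h ▸ hj)
  refine ⟨b.repr, fun z => ?_⟩
  set p := V.starProjection z with hp
  have hpV : p ∈ V := Submodule.starProjection_apply_mem V z
  have hpV' : z - p ∈ Vᗮ := Submodule.sub_starProjection_mem_orthogonal z
  rw [← b.repr.norm_map (z - p), ← b.repr.norm_map p, EuclideanSpace.norm_sq_eq,
    EuclideanSpace.norm_sq_eq, ← Finset.sum_sub_distrib]
  refine Finset.sum_congr rfl fun i _ => ?_
  have hz : b.repr z i = b.repr (z - p) i + b.repr p i := by
    rw [map_sub, PiLp.sub_apply]; ring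
  simp only [Real.norm_eq_abs, sq_abs]
  by_cases hi : (i : ℕ) < k
  · have : b.repr (z - p) i = 0 := by
      rw [b.repr_apply_apply]; exact Submodule.inner_right_of_mem_orthogonal (hbV i hi) hpV'
    rw [if_pos hi, hz, this]; ring
  · have : b.repr p i = 0 := by
      rw [b.repr_apply_apply]; exact Submodule.inner_left_of_mem_orthogonal hpV (hbV' i hi)
    rw [if_neg hi, hz, this]; ring

/-- If the vectors `v i` are positively related, the local model has a Morse chart at the origin,
whose index is the dimension of their span. -/
lemma exists_morse_chart_localModel {n : ℕ} {ι : Type*} {A : Finset ι} (hA : A.Nonempty)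
    (v : ι → EuclideanSpace ℝ (Fin n)) (hrel : HasPositiveRelation v A) :
    ∃ φ : OpenPartialHomeomorph (EuclideanSpace ℝ (Fin n)) (EuclideanSpace ℝ (Fin n)),
      0 ∈ φ.source ∧ φ 0 = 0 ∧ ∀ y ∈ φ.source, localModel A hA v y =
        ∑ i : Fin n, (if (i : ℕ) < Module.finrank ℝ (Submodule.span ℝ (v '' A))
          then -(φ y i) ^ 2 else (φ y i) ^ 2) := by
  set V := Submodule.span ℝ (v '' (A : Set ι)) with hV
  obtain ⟨c, hc, hcoer⟩ := hrel.exists_coercive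
  let p : EuclideanSpace ℝ (Fin n) →L[ℝ] EuclideanSpace ℝ (Fin n) := V.starProjection
  have hpV : ∀ h, p h ∈ V := fun h => Submodule.starProjection_apply_mem V h
  have hpp : ∀ h, p (p h) = p h := fun h => Submodule.starProjection_eq_self_iff.mpr (hpV h)
  let s : EuclideanSpace ℝ (Fin n) → ℝ := fun h => A.sup' hA fun i => inner ℝ h (v i)
  have hsc : Continuous s := Continuous.finset_sup'_apply hA fun i _ => by fun_prop
  have hpv : ∀ h, ∀ i ∈ A, inner ℝ (p h) (v i) = inner ℝ h (v i) := by
    intro h i hi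
    have hvi : v i ∈ V := Submodule.subset_span ⟨i, hi, rfl⟩
    have h1 : inner ℝ (h - p h) (v i) = 0 :=
      Submodule.inner_left_of_mem_orthogonal hvi (Submodule.sub_starProjection_mem_orthogonal h)
    rw [inner_sub_left] at h1
    linarith
  have hsp : ∀ h h' (t : ℝ), 0 ≤ t → p h' = t • p h → s h' = t * s h := by
    intro h h' t ht hh
    have h1 : s h' = A.sup' hA fun i => t * inner ℝ h (v i) :=
      Finset.sup'_congr hA rfl fun i hi => by
        rw [← hpv h' i hi, hh, real_inner_smul_left, hpv h i hi]
    rw [h1]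
    exact (Finset.apply_sup'_eq_sup'_comp hA (fun x => t * x)
      fun x y => mul_max_of_nonneg x y ht).symm
  have hs0 : ∀ h, p h = 0 → s h = 0 := by
    intro h hh
    have := hsp h h 0 le_rfl (by simp [hh])
    simpa using this
  have hsge : ∀ h, c * ‖p h‖ ≤ s h := by
    intro h
    by_cases hh : p h = 0
    · simp [hh, hs0 h hh]
    · obtain ⟨i, hi, hle⟩ := hcoer (p h) (hpV h) hh
      rw [hpv h i hi] at hle
      exact hle.trans (Finset.le_sup' (fun i => inner ℝ h (v i)) hi)
  -- The local model is ½‖h − p h‖² − σ(h), so Ψ should give the V-part norm √σ. For z with ‖p z‖ =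
  -- ρ > 0, inverting along its ray means solving mr − r²/2 = ρ² with m = s(z)/ρ. `Rad` is the
  -- smaller root, rationalized so that its denominator is at least c‖p z‖.
  let σ : EuclideanSpace ℝ (Fin n) → ℝ := fun h => s h - 1 / 2 * ‖p h‖ ^ 2
  let Rad : EuclideanSpace ℝ (Fin n) → ℝ := fun z =>
    2 * ‖p z‖ ^ 3 / (s z + √(s z ^ 2 - 2 * ‖p z‖ ^ 4))
  let Ψ : EuclideanSpace ℝ (Fin n) → EuclideanSpace ℝ (Fin n) := fun h =>
    (√2)⁻¹ • (h - p h) + (√(σ h) / ‖p h‖) • p h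
  let Ψ' : EuclideanSpace ℝ (Fin n) → EuclideanSpace ℝ (Fin n) := fun z =>
    √2 • (z - p z) + (Rad z / ‖p z‖) • p z
  have h2 : √2 ≠ 0 := by positivity
  have hpΨ : ∀ h, p (Ψ h) = (√(σ h) / ‖p h‖) • p h := by
    intro h; simp [Ψ, hpp]
  have hpΨ' : ∀ h, p (Ψ' h) = (Rad h / ‖p h‖) • p h := by
    intro h; simp [Ψ', hpp]
  have hqΨ : ∀ h, Ψ h - p (Ψ h) = (√2)⁻¹ • (h - p h) := by
    intro h; rw [hpΨ]; simp [Ψ]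
  have hqΨ' : ∀ h, Ψ' h - p (Ψ' h) = √2 • (h - p h) := by
    intro h; rw [hpΨ']; simp [Ψ']
  have hΨc : Continuous Ψ := by
    refine continuous_iff_continuousAt.mpr fun x => ContinuousAt.add (by fun_prop) ?_
    refine continuousAt_div_norm_smul (by fun_prop) (by fun_prop) fun hx => ?_
    simp [σ, hx, hs0 x hx]
  have hRadc : Continuous Rad := by
    refine continuous_iff_continuousAt.mpr fun x => ?_
    by_cases hx : p x = 0
    · have h1 : Tendsto Rad (𝓝 x) (𝓝 0) := by
        refine squeeze_zero_norm (a := fun z => 2 / c * ‖p z‖ ^ 2) (fun z => ?_) ?_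
        · by_cases hz : p z = 0
          · simp [Rad, hz]
          have hz' : 0 < ‖p z‖ := norm_pos_iff.mpr hz
          have hpos : 0 < s z := (mul_pos hc hz').trans_le (hsge z)
          have hden : c * ‖p z‖ ≤ s z + √(s z ^ 2 - 2 * ‖p z‖ ^ 4) := by
            have := Real.sqrt_nonneg (s z ^ 2 - 2 * ‖p z‖ ^ 4)
            linarith [hsge z]
          have hden0 : 0 < s z + √(s z ^ 2 - 2 * ‖p z‖ ^ 4) := by positivity
          rw [Real.norm_of_nonneg (by positivity), div_le_iff₀ hden0]
          calc 2 * ‖p z‖ ^ 3 = 2 / c * ‖p z‖ ^ 2 * (c * ‖p z‖) := by field_simp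
            _ ≤ _ := by gcongr
        · have : Continuous fun z => 2 / c * ‖p z‖ ^ 2 := by fun_prop
          have := this.tendsto x
          simpa [hx] using this
      have h2 : Rad x = 0 := by simp [Rad, hx]
      rw [ContinuousAt, h2]
      exact h1
    · have hpos : 0 < s x := (mul_pos hc (norm_pos_iff.mpr hx)).trans_le (hsge x)
      refine ContinuousAt.div (by fun_prop) (by fun_prop) ?_
      positivity
  have hΨ'c : Continuous Ψ' := by
    refine continuous_iff_continuousAt.mpr fun x => ContinuousAt.add (by fun_prop) ?_
    refine continuousAt_div_norm_smul hRadc.continuousAt (by fun_prop) fun hx => ?_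
    simp [Rad, hx]
  -- Here r < c ≤ m, which selects the smaller root; in U' the bound 2ρ² < c² ≤ m² keeps the
  -- discriminant positive. Both bounds are meant off the kernel of p.
  let U : Set (EuclideanSpace ℝ (Fin n)) := {h | ‖p h‖ < c}
  let U' : Set (EuclideanSpace ℝ (Fin n)) := {z | 2 * ‖p z‖ ^ 2 < c ^ 2}
  have hU : IsOpen U := isOpen_lt (by fun_prop) continuous_const
  have hU' : IsOpen U' := isOpen_lt (by fun_prop) continuous_const
  have hσ : ∀ h ∈ U, 0 ≤ σ h := by
    intro h hh
    have h1 : ‖p h‖ < c := hh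
    have := hsge h
    simp only [σ]
    nlinarith [norm_nonneg (p h)]
  obtain ⟨φ, hφs, hφ⟩ := exists_openPartialHomeomorph hU hU' hΨc.continuousOn hΨ'c.continuousOn
    (fun h hh _ => by
      have hrc : ‖p h‖ < c := hh
      have h1 : Ψ' (Ψ h) = (h - p h) + (Rad (Ψ h) / ‖p (Ψ h)‖) • p (Ψ h) := by
        simp only [Ψ']
        rw [hqΨ, smul_smul, mul_inv_cancel₀ h2, one_smul]
      rw [h1]
      by_cases hx : p h = 0
      · rw [hpΨ, hx]; simp
      set r := ‖p h‖ with hr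
      have hrpos : 0 < r := norm_pos_iff.mpr hx
      have hs := hsge h
      rw [← hr] at hs
      have hlt : r ^ 2 < s h := by nlinarith
      have hσpos : 0 < σ h := by simp only [σ]; rw [← hr]; nlinarith
      set ρ := √(σ h) with hρ
      have hρpos : 0 < ρ := Real.sqrt_pos.mpr hσpos
      have hρ2 : ρ ^ 2 = s h - 1 / 2 * r ^ 2 := Real.sq_sqrt hσpos.le
      have hsΨ : s (Ψ h) = ρ / r * s h := hsp h _ _ (by positivity) (hpΨ h)
      have hnΨ : ‖p (Ψ h)‖ = ρ := by
        rw [hpΨ, norm_smul, ← hr, Real.norm_of_nonneg (by positivity), ← hρ,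
          div_mul_cancel₀ _ hrpos.ne']
      have hsq : √(s (Ψ h) ^ 2 - 2 * ‖p (Ψ h)‖ ^ 4) = ρ / r * (s h - r ^ 2) := by
        rw [Real.sqrt_eq_iff_mul_self_eq_of_pos (mul_pos (by positivity) (by linarith)), hsΨ, hnΨ]
        have : ρ ^ 4 = ρ ^ 2 * (s h - 1 / 2 * r ^ 2) := by rw [← hρ2]; ring
        rw [this]; field_simp; ring
      have hRad : Rad (Ψ h) = r := by
        simp only [Rad]
        rw [hsq, hsΨ, hnΨ]
        have h3 : ρ / r * s h + ρ / r * (s h - r ^ 2) = 2 * ρ ^ 3 / r := by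
          have : ρ ^ 3 = ρ * (s h - 1 / 2 * r ^ 2) := by rw [← hρ2]; ring
          rw [this]; field_simp; ring
        rw [h3]; field_simp
      rw [hRad, hnΨ, hpΨ, smul_smul, ← hr, ← hρ]
      have : r / ρ * (ρ / r) = 1 := by field_simp
      rw [this, one_smul, sub_add_cancel])
    (fun z hz _ => by
      have hrc : 2 * ‖p z‖ ^ 2 < c ^ 2 := hz
      have h1 : Ψ (Ψ' z) = (z - p z) + (√(σ (Ψ' z)) / ‖p (Ψ' z)‖) • p (Ψ' z) := by
        simp only [Ψ]
        rw [hqΨ', smul_smul, inv_mul_cancel₀ h2, one_smul]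
      rw [h1]
      by_cases hx : p z = 0
      · rw [hpΨ', hx]; simp
      have hs := hsge z
      set ρ := ‖p z‖ with hρ
      have hρpos : 0 < ρ := norm_pos_iff.mpr hx
      have hspos : 0 < s z := (mul_pos hc hρpos).trans_le hs
      set D := √(s z ^ 2 - 2 * ρ ^ 4) with hD
      have hD0 : 0 ≤ D := Real.sqrt_nonneg _
      have hD2 : D ^ 2 = s z ^ 2 - 2 * ρ ^ 4 := by
        refine Real.sq_sqrt ?_
        have e1 : (c * ρ) ^ 2 ≤ s z ^ 2 := by gcongr
        have e2 : 2 * ρ ^ 2 * ρ ^ 2 ≤ c ^ 2 * ρ ^ 2 := by gcongr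
        nlinarith
      have hsD : 0 < s z + D := by positivity
      have hRad : Rad z = 2 * ρ ^ 3 / (s z + D) := rfl
      set r := Rad z with hr
      have hrpos : 0 < r := by rw [hRad]; positivity
      have hr1 : r * (s z + D) = 2 * ρ ^ 3 := by rw [hRad]; field_simp
      have hr2 : s z - D = r * ρ := by
        have : (s z - D) * (s z + D) = r * ρ * (s z + D) := by
          calc (s z - D) * (s z + D) = s z ^ 2 - D ^ 2 := by ring
            _ = (2 * ρ ^ 3) * ρ := by rw [hD2]; ring
            _ = _ := by rw [← hr1]; ring
        exact mul_right_cancel₀ hsD.ne' this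
      have hnΨ : ‖p (Ψ' z)‖ = r := by
        rw [hpΨ', norm_smul, ← hr, ← hρ, Real.norm_of_nonneg (by positivity)]; field_simp
      have hsΨ : s (Ψ' z) = r / ρ * s z := hsp z _ _ (by positivity) (hpΨ' z)
      have hσ' : σ (Ψ' z) = ρ ^ 2 := by
        simp only [σ]
        rw [hnΨ, hsΨ]
        have : r * (2 * s z) = r * (r * ρ) + 2 * ρ ^ 3 := by rw [← hr1, ← hr2]; ring
        field_simp
        nlinarith
      rw [hσ', Real.sqrt_sq hρpos.le, hnΨ, hpΨ', smul_smul, ← hr, ← hρ]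
      have : ρ / r * (r / ρ) = 1 := by field_simp
      rw [this, one_smul, sub_add_cancel])
  obtain ⟨I, hI⟩ := exists_linearIsometryEquiv_adapted V
  have hΨ0 : Ψ 0 = 0 := by simp [Ψ]
  have hsrc : (φ.transHomeomorph I.toHomeomorph).source = φ.source := rfl
  have hcoe : ∀ y, φ.transHomeomorph I.toHomeomorph y = I (Ψ y) := by
    intro y; simp [hφ]
  refine ⟨φ.transHomeomorph I.toHomeomorph, ?_, ?_, fun y hy => ?_⟩
  · rw [hsrc, hφs]
    simp [U, U', hΨ0, hc]
  · rw [hcoe, hΨ0, map_zero]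
  · rw [hsrc, hφs] at hy
    simp only [hcoe]
    rw [hI]
    change _ = ‖Ψ y - p (Ψ y)‖ ^ 2 - ‖p (Ψ y)‖ ^ 2
    have e1 : ‖Ψ y - p (Ψ y)‖ ^ 2 = 1 / 2 * ‖y - p y‖ ^ 2 := by
      rw [hqΨ, norm_smul, mul_pow, norm_inv, Real.norm_of_nonneg (Real.sqrt_nonneg 2), inv_pow,
        Real.sq_sqrt (by norm_num)]
      norm_num
    have e2 : ‖p (Ψ y)‖ ^ 2 = σ y := by
      rw [hpΨ]
      by_cases hx : p y = 0
      · simp [hx, σ, hs0 y hx]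
      · rw [norm_smul, Real.norm_of_nonneg (by positivity),
          div_mul_cancel₀ _ (norm_ne_zero_iff.mpr hx), Real.sq_sqrt (hσ y hy.1)]
    have e3 : ‖y‖ ^ 2 = ‖p y‖ ^ 2 + ‖y - p y‖ ^ 2 := by
      have h1 : inner ℝ (p y) (y - p y) = 0 := Submodule.inner_right_of_mem_orthogonal (hpV y)
        (Submodule.sub_starProjection_mem_orthogonal y)
      have h3 := norm_add_sq_real (p y) (y - p y)
      rw [h1, add_sub_cancel] at h3
      linarith
    rw [e1, e2]
    simp only [σ, localModel]
    change 1 / 2 * ‖y‖ ^ 2 - s y = _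
    rw [e3]; ring

/-! ### Positive relations and relative interiors -/

section IntrinsicInterior

variable {ι E : Type*} [NormedAddCommGroup E] [InnerProductSpace ℝ E]

/-- For each i the hull still contains c + ε(c − P_i) for some ε > 0. Writing this point as a convex
combination gives a nonnegative relation with positive i-th coefficient; these relations are summed
over i. -/
lemma HasPositiveRelation.of_mem_intrinsicInterior [DecidableEq ι] {α : Finset ι} {P : ι → E} {c : E}
    (hc : c ∈ intrinsicInterior ℝ (convexHull ℝ (P '' (α : Set ι)))) :
    HasPositiveRelation (fun i => P i - c) α := by
  set S := convexHull ℝ (P '' (α : Set ι)) with hS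
  obtain ⟨y, hy, hyc⟩ := mem_intrinsicInterior.mp hc
  have key : ∀ i ∈ α, ∃ m : ι → ℝ, (∀ j ∈ α, 0 ≤ m j) ∧ 0 < m i ∧
      ∑ j ∈ α, m j • (P j - c) = 0 := by
    intro i hi
    have hPi : P i ∈ affineSpan ℝ S :=
      subset_affineSpan ℝ _ (subset_convexHull ℝ _ ⟨i, hi, rfl⟩)
    let q : ℝ → affineSpan ℝ S := fun t =>
      ⟨AffineMap.lineMap (y : E) (P i) (-t), AffineMap.lineMap_mem _ y.2 hPi⟩
    have hqc : Continuous q :=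
      (AffineMap.lineMap_continuous.comp continuous_neg).subtype_mk _
    have hq0 : q 0 = y := Subtype.ext (by simp [q])
    have hev : ∀ᶠ t in 𝓝 (0 : ℝ), q t ∈ interior ((↑) ⁻¹' S : Set (affineSpan ℝ S)) :=
      hqc.continuousAt.eventually_mem (by rw [hq0]; exact isOpen_interior.mem_nhds hy)
    obtain ⟨ε, hε, hεpos⟩ := ((hev.filter_mono nhdsWithin_le_nhds).and
      (self_mem_nhdsWithin (s := Ioi (0 : ℝ)))).exists
    have hmem : ((q ε : affineSpan ℝ S) : E) ∈ S :=
      (interior_subset hε : q ε ∈ ((↑) ⁻¹' S : Set (affineSpan ℝ S)))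
    have hqe : ((q ε : affineSpan ℝ S) : E) = c + ε • (c - P i) := by
      have : ((q ε : affineSpan ℝ S) : E) = AffineMap.lineMap (y : E) (P i) (-ε) := rfl
      rw [this, hyc, AffineMap.lineMap_apply_module']
      module
    rw [hqe, hS, mem_convexHull_image_finset] at hmem
    obtain ⟨l, hl0, hl1, hl⟩ := hmem
    have hε' : (0 : ℝ) < ε := hεpos
    refine ⟨fun j => l j + if j = i then ε else 0, fun j hj => ?_, ?_, ?_⟩
    · have := hl0 j hj
      dsimp only
      split_ifs <;> linarith
    · have := hl0 i hi
      simp only [if_true]; linarith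
    · simp only [add_smul, Finset.sum_add_distrib, ite_smul, zero_smul]
      rw [Finset.sum_ite_eq' α i, if_pos hi]
      simp only [smul_sub, Finset.sum_sub_distrib, ← Finset.sum_smul]
      rw [hl, hl1]
      module
  choose! m hm0 hmpos hmsum using key
  refine ⟨fun j => ∑ i ∈ α, m i j, fun j hj => ?_, ?_⟩
  · exact Finset.sum_pos' (fun i hi => hm0 i hi j hj) ⟨j, hj, hmpos j hj⟩
  · simp only [Finset.sum_smul]
    rw [Finset.sum_comm]
    exact Finset.sum_eq_zero hmsum

lemma sub_mem_span_of_mem_affineSpan {S : Set ι} {P : ι → E} {c y : E}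
    (hy : y ∈ affineSpan ℝ (P '' S)) :
    y - c ∈ Submodule.span ℝ ((fun i => P i - c) '' S) := by
  have h : affineSpan ℝ (P '' S) ≤
      AffineSubspace.mk' c (Submodule.span ℝ ((fun i => P i - c) '' S)) := by
    rw [affineSpan_le]
    rintro _ ⟨i, hi, rfl⟩
    rw [SetLike.mem_coe, AffineSubspace.mem_mk']
    exact Submodule.subset_span ⟨i, hi, rfl⟩
  have := h hy
  rwa [AffineSubspace.mem_mk'] at this

/-- Normalizing the relation writes c with strictly positive weights. Nearby points of the affine
span have weights depending continuously on the point, through a linear right inverse, so positivity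
persists. -/
lemma HasPositiveRelation.mem_intrinsicInterior [FiniteDimensional ℝ E] {α : Finset ι}
    (hα : α.Nonempty) {P : ι → E} {c : E} (h : HasPositiveRelation (fun i => P i - c) α) :
    c ∈ intrinsicInterior ℝ (convexHull ℝ (P '' (α : Set ι))) := by
  classical
  obtain ⟨μ, hμ, hsum⟩ := h
  have hSpos : 0 < ∑ i ∈ α, μ i := Finset.sum_pos hμ hα
  let m : ι → ℝ := fun i => μ i / ∑ j ∈ α, μ j
  have hm : ∀ i ∈ α, 0 < m i := fun i hi => div_pos (hμ i hi) hSpos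
  have hm1 : ∑ i ∈ α, m i = 1 := by rw [← Finset.sum_div, div_self hSpos.ne']
  have hmc : ∑ i ∈ α, m i • P i = c := by
    have h1 : ∑ i ∈ α, m i • (P i - c) = 0 := by
      have : ∀ i, m i • (P i - c) = (∑ j ∈ α, μ j)⁻¹ • μ i • (P i - c) := by
        intro i; simp only [m, smul_smul, div_eq_inv_mul]
      simp only [this, ← Finset.smul_sum]
      rw [hsum, smul_zero]
    simp only [smul_sub, Finset.sum_sub_distrib, ← Finset.sum_smul, hm1, one_smul] at h1
    exact sub_eq_zero.mp h1
  set S := convexHull ℝ (P '' (α : Set ι)) with hS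
  have hcS : c ∈ S := mem_convexHull_image_finset.mpr ⟨m, fun i hi => (hm i hi).le, hm1, hmc⟩
  let T : (α → ℝ) →ₗ[ℝ] E := Fintype.linearCombination ℝ fun i : α => P i - c
  obtain ⟨R, hR⟩ := T.rangeRestrict.exists_rightInverse_of_surjective
    (LinearMap.range_eq_top.mpr T.surjective_rangeRestrict)
  have hRc : Continuous R := R.continuous_of_finiteDimensional
  have hrange : ∀ y : affineSpan ℝ S, (y : E) - c ∈ T.range := by
    intro y
    have h1 : (y : E) ∈ affineSpan ℝ (P '' (α : Set ι)) := by
      rw [← affineSpan_convexHull]; exact y.2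
    have h2 := sub_mem_span_of_mem_affineSpan (c := c) h1
    rw [Fintype.range_linearCombination]
    convert h2 using 2
    ext x; simp
  let a : affineSpan ℝ S → α → ℝ := fun y => R ⟨(y : E) - c, hrange y⟩
  have hac : Continuous a := hRc.comp ((continuous_subtype_val.sub continuous_const).subtype_mk _)
  have hasum : ∀ y, ∑ i, a y i • (P i - c) = (y : E) - c := by
    intro y
    have := congrArg Subtype.val (LinearMap.congr_fun hR ⟨(y : E) - c, hrange y⟩)
    simpa [T, Fintype.linearCombination_apply] using this
  let y₀ : affineSpan ℝ S := ⟨c, subset_affineSpan ℝ _ hcS⟩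
  have ha0 : a y₀ = 0 := by
    have : (⟨(y₀ : E) - c, hrange y₀⟩ : T.range) = 0 := Subtype.ext (sub_self c)
    simp only [a, this, map_zero]
  rw [_root_.mem_intrinsicInterior]
  refine ⟨y₀, mem_interior_iff_mem_nhds.mpr ?_, rfl⟩
  have hev : ∀ᶠ y in 𝓝 y₀, ∀ i : α, 0 < m i + a y i - (∑ j, a y j) * m i := by
    rw [eventually_all]
    intro i
    have hcont : Continuous fun y => m i + a y i - (∑ j, a y j) * m i := by fun_prop
    refine hcont.continuousAt.eventually_const_lt ?_
    simpa [ha0] using hm i i.2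
  filter_upwards [hev] with y hy
  -- The correction −(Σa)m restores total weight 1; it is a multiple of the weights of c, so the
  -- combination is exactly y.
  let b : ι → ℝ := fun i => if hi : i ∈ α then m i + a y ⟨i, hi⟩ - (∑ j, a y j) * m i else 0
  have hb : ∀ i : α, b i = m i + a y i - (∑ j, a y j) * m i := by
    intro i; simp [b]
  refine mem_convexHull_image_finset.mpr ⟨b, fun i hi => ?_, ?_, ?_⟩
  · rw [hb ⟨i, hi⟩]; exact (hy ⟨i, hi⟩).le
  · rw [← Finset.sum_coe_sort]
    have hm1' : ∑ i : α, m i = 1 := by rw [Finset.sum_coe_sort α m, hm1]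
    simp only [hb, Finset.sum_sub_distrib, Finset.sum_add_distrib, ← Finset.mul_sum, hm1']
    ring
  · rw [← Finset.sum_coe_sort α fun i => b i • P i]
    have hmc' : ∑ i : α, m i • P i = c := by rw [Finset.sum_coe_sort α fun i => m i • P i, hmc]
    simp only [hb, sub_smul, add_smul, Finset.sum_sub_distrib, Finset.sum_add_distrib, mul_smul,
      ← Finset.smul_sum, hmc']
    have := hasum y
    simp only [smul_sub, Finset.sum_sub_distrib, ← Finset.sum_smul] at this
    rw [add_sub_assoc, this]
    abel

end IntrinsicInterior

variable {n N : ℕ}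

/-! ### Local form of g and its critical points -/

section MinSet

variable (P : Fin N → EuclideanSpace ℝ (Fin n)) (w : Fin N → ℝ)

/-- The set of indices at which the minimum `g x` is attained. -/
noncomputable def minSet (x : EuclideanSpace ℝ (Fin n)) : Finset (Fin N) :=
  {i | ∀ j, gi P w i x ≤ gi P w j x}

lemma g_le (i : Fin N) (x : EuclideanSpace ℝ (Fin n)) : g P w x ≤ gi P w i x :=
  ciInf_le (finite_range _).bddBelow i

variable {P w}

lemma mem_minSet [Nonempty (Fin N)] {i : Fin N} {x : EuclideanSpace ℝ (Fin n)} :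
    i ∈ minSet P w x ↔ gi P w i x = g P w x := by
  simp only [minSet, Finset.mem_filter, Finset.mem_univ, true_and]
  exact ⟨fun h => le_antisymm (le_ciInf h) (g_le P w i x), fun h j => h.trans_le (g_le P w j x)⟩

variable (P w)

lemma minSet_nonempty [Nonempty (Fin N)] (x : EuclideanSpace ℝ (Fin n)) :
    (minSet P w x).Nonempty := by
  obtain ⟨i, hi⟩ := exists_eq_ciInf_of_finite (f := fun i => gi P w i x)
  exact ⟨i, mem_minSet.mpr hi⟩

lemma continuous_gi (i : Fin N) : Continuous (gi P w i) := by
  unfold gi; fun_prop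

lemma continuous_g [Nonempty (Fin N)] : Continuous (g P w) := by
  have h : g P w = fun x => Finset.univ.inf' Finset.univ_nonempty fun i => gi P w i x := by
    ext x; rw [Finset.inf'_univ_eq_ciInf]; rfl
  rw [h]
  exact Continuous.finset_inf'_apply _ fun i _ => continuous_gi P w i

lemma gi_add (i : Fin N) (c h : EuclideanSpace ℝ (Fin n)) :
    gi P w i (c + h) = gi P w i c + 1 / 2 * ‖h‖ ^ 2 - inner ℝ h (P i - c) := by
  have h1 : c + h - P i = h - (P i - c) := by abel
  have h2 : c - P i = -(P i - c) := by abel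
  simp only [gi]
  rw [h1, h2, norm_neg, norm_sub_sq_real]
  ring

/-- Near any point, `g` is a constant plus its local model. -/
lemma eventually_g_eq_localModel [Nonempty (Fin N)] (c : EuclideanSpace ℝ (Fin n)) :
    ∀ᶠ h in 𝓝 (0 : EuclideanSpace ℝ (Fin n)), g P w (c + h) =
      g P w c + localModel (minSet P w c) (minSet_nonempty P w c) (fun i => P i - c) h := by
  have hev : ∀ᶠ h in 𝓝 (0 : EuclideanSpace ℝ (Fin n)), ∀ j, j ∉ minSet P w c →
      g P w (c + h) < gi P w j (c + h) := by
    rw [eventually_all]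
    intro j
    by_cases hj : j ∈ minSet P w c
    · simp [hj]
    · have hlt : g P w c < gi P w j c :=
        lt_of_le_of_ne (g_le P w j c) fun h => hj (mem_minSet.mpr h.symm)
      have h1 := ((continuous_g P w).comp (continuous_const.add continuous_id)).continuousAt
        |>.eventually_lt ((continuous_gi P w j).comp (continuous_const.add continuous_id)).continuousAt
          (x₀ := (0 : EuclideanSpace ℝ (Fin n))) (by simpa using hlt)
      filter_upwards [h1] with h hh _
      exact hh
  filter_upwards [hev] with h hh
  set A := minSet P w c with hA
  have hgi : ∀ i ∈ A, gi P w i (c + h) = g P w c + 1 / 2 * ‖h‖ ^ 2 - inner ℝ h (P i - c) := by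
    intro i hi
    rw [gi_add, mem_minSet.mp hi]
  simp only [localModel]
  apply le_antisymm
  · obtain ⟨i, hi, hie⟩ := A.exists_mem_eq_sup' (minSet_nonempty P w c) fun i => inner ℝ h (P i - c)
    rw [hie]
    have := g_le P w i (c + h)
    rw [hgi i hi] at this
    linarith
  · obtain ⟨i, hi⟩ := minSet_nonempty P w (c + h)
    rw [mem_minSet] at hi
    have hiA : i ∈ A := by
      by_contra hcon
      exact (hh i hcon).ne hi.symm
    rw [← hi, hgi i hiA]
    have := Finset.le_sup' (fun i => inner ℝ h (P i - c)) hiA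
    linarith

lemma exists_translation_chart [Nonempty (Fin N)] (c : EuclideanSpace ℝ (Fin n)) :
    ∃ T : OpenPartialHomeomorph (EuclideanSpace ℝ (Fin n)) (EuclideanSpace ℝ (Fin n)),
      0 ∈ T.source ∧ T 0 = c ∧ ∀ h ∈ T.source, g P w (T h) =
        g P w c + localModel (minSet P w c) (minSet_nonempty P w c) (fun i => P i - c) h := by
  obtain ⟨O, hO, hOo, h0⟩ := _root_.eventually_nhds_iff.mp (eventually_g_eq_localModel P w c)
  obtain ⟨T, hTs, hT⟩ := exists_openPartialHomeomorph (f := fun h => c + h) (g := fun y => y - c)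
    hOo isOpen_univ (by fun_prop) (by fun_prop) (fun x _ _ => add_sub_cancel_left _ _)
    (fun y _ _ => add_sub_cancel _ _)
  refine ⟨T, by simpa [hTs] using h0, by simp [hT], fun h hh => ?_⟩
  rw [hTs] at hh
  rw [hT]
  exact hO h hh.1

lemma hasPositiveRelation_of_isTopCritical [Nonempty (Fin N)] {c : EuclideanSpace ℝ (Fin n)}
    (hc : IsTopCritical (g P w) c) : HasPositiveRelation (fun i => P i - c) (minSet P w c) := by
  by_contra hrel
  obtain ⟨T, h0, hT0, hT⟩ := exists_translation_chart P w c
  refine hc ?_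
  rw [← hT0]
  exact IsTopRegular.of_comp T h0 hT (isTopRegular_localModel (minSet_nonempty P w c) _ hrel)

lemma isCriticalOfIndex_of_hasPositiveRelation [Nonempty (Fin N)] {c : EuclideanSpace ℝ (Fin n)}
    (hrel : HasPositiveRelation (fun i => P i - c) (minSet P w c)) :
    IsCriticalOfIndex (g P w) c (Module.finrank ℝ
      (Submodule.span ℝ ((fun i => P i - c) '' (minSet P w c : Set (Fin N))))) := by
  obtain ⟨T, h0, hT0, hT⟩ := exists_translation_chart P w c
  obtain ⟨φ, hφ0, hφ, hφy⟩ := exists_morse_chart_localModel (minSet_nonempty P w c) _ hrel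
  have hk := Submodule.finrank_le
    (Submodule.span ℝ ((fun i => P i - c) '' (minSet P w c : Set (Fin N))))
  rw [finrank_euclideanSpace_fin] at hk
  have hTc : T.symm c = 0 := by rw [← hT0, T.left_inv h0]
  have hcs : c ∈ (T.symm.trans φ).source := by
    simp only [OpenPartialHomeomorph.trans_source, OpenPartialHomeomorph.symm_source,
      mem_inter_iff, mem_preimage, hTc]
    exact ⟨hT0 ▸ T.map_source h0, hφ0⟩
  have hc0 : (T.symm.trans φ) c = 0 := by
    rw [OpenPartialHomeomorph.trans_apply, hTc, hφ]
  have hform : ∀ y ∈ (T.symm.trans φ).source, g P w y = g P w c + ∑ i : Fin n,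
      (if (i : ℕ) < Module.finrank ℝ
        (Submodule.span ℝ ((fun i => P i - c) '' (minSet P w c : Set (Fin N))))
        then -((T.symm.trans φ) y i) ^ 2 else ((T.symm.trans φ) y i) ^ 2) := by
    intro y hy
    simp only [OpenPartialHomeomorph.trans_source, OpenPartialHomeomorph.symm_source,
      mem_inter_iff, mem_preimage] at hy
    have := hT _ (T.map_target hy.1)
    rw [T.right_inv hy.1, hφy _ hy.2] at this
    exact this
  exact ⟨not_isTopRegular_of_chart hk _ hcs hc0 hform, hk, _, hcs, hc0, hform⟩

end MinSet

/-! ### Active cells and their dimension -/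

section Cells

variable {P : Fin N → EuclideanSpace ℝ (Fin n)} {w : Fin N → ℝ}

lemma IsActive.exists_center [Nonempty (Fin N)] {α : Finset (Fin N)} (h : IsActive P w α) :
    ∃ c, center P w α = {c} ∧ minSet P w c = α ∧ HasPositiveRelation (fun i => P i - c) α := by
  obtain ⟨-, c, hc, hint, ⟨i, hi, hgi⟩, hj⟩ := h
  refine ⟨c, hc, ?_, HasPositiveRelation.of_mem_intrinsicInterior hint⟩
  have hsep : c ∈ Sep P w α := (hc.symm ▸ mem_singleton c : c ∈ center P w α).1
  ext k
  rw [mem_minSet]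
  constructor
  · intro hk
    by_contra hkα
    exact (hj k hkα).ne hk.symm
  · intro hk
    rw [hgi]
    exact hsep k hk i hi

/-- A second point y would make ⟨y − c, P_i − c⟩ independent of i, whereas the positive relation
forces both signs to occur. -/
lemma center_minSet [Nonempty (Fin N)] {c : EuclideanSpace ℝ (Fin n)}
    (hrel : HasPositiveRelation (fun i => P i - c) (minSet P w c)) :
    center P w (minSet P w c) = {c} := by
  have hint := hrel.mem_intrinsicInterior (minSet_nonempty P w c)
  apply Subset.antisymm
  · rintro y ⟨hsep, haff⟩
    have hspan := sub_mem_span_of_mem_affineSpan (c := c) haff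
    by_contra hy
    have hne : y - c ≠ 0 := sub_ne_zero.mpr hy
    obtain ⟨i, hi, hipos⟩ := hrel.exists_inner_pos hspan hne
    obtain ⟨j, hj, hjpos⟩ := hrel.exists_inner_pos (Submodule.neg_mem _ hspan) (neg_ne_zero.mpr hne)
    have h1 := hsep i hi j hj
    have h2 := gi_add P w i c (y - c)
    have h3 := gi_add P w j c (y - c)
    rw [add_sub_cancel, mem_minSet.mp hi] at h2
    rw [add_sub_cancel, mem_minSet.mp hj] at h3
    rw [inner_neg_left] at hjpos
    linarith
  · rintro _ rfl
    refine ⟨fun i hi j hj => by rw [mem_minSet.mp hi, mem_minSet.mp hj], ?_⟩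
    exact convexHull_subset_affineSpan _ (intrinsicInterior_subset hint)

lemma mem_Pow_minSet [Nonempty (Fin N)] (c : EuclideanSpace ℝ (Fin n)) :
    c ∈ Pow P w (minSet P w c) :=
  subset_closure ⟨fun _ hi => mem_minSet.mp hi, fun j hj =>
    lt_of_le_of_ne (g_le P w j c) fun h => hj (mem_minSet.mpr h.symm)⟩

lemma isActive_minSet [Nonempty (Fin N)] {c : EuclideanSpace ℝ (Fin n)}
    (hrel : HasPositiveRelation (fun i => P i - c) (minSet P w c)) :
    IsActive P w (minSet P w c) := by
  obtain ⟨i, hi⟩ := minSet_nonempty P w c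
  exact ⟨⟨c, mem_Pow_minSet c⟩, c, center_minSet hrel,
    hrel.mem_intrinsicInterior (minSet_nonempty P w c), ⟨i, hi, (mem_minSet.mp hi).symm⟩,
    fun j hj => lt_of_le_of_ne (g_le P w j c) fun h => hj (mem_minSet.mpr h.symm)⟩

lemma fi_eq (i : Fin N) (x : EuclideanSpace ℝ (Fin n)) :
    fi P w i x = 1 / 2 * ‖x‖ ^ 2 - gi P w i x := by
  simp only [fi, gi]
  rw [norm_sub_sq_real]
  ring

lemma f_eq [Nonempty (Fin N)] (x : EuclideanSpace ℝ (Fin n)) :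
    f P w x = 1 / 2 * ‖x‖ ^ 2 - g P w x := by
  apply le_antisymm
  · refine ciSup_le fun i => ?_
    rw [fi_eq]
    linarith [g_le P w i x]
  · obtain ⟨i, hi⟩ := minSet_nonempty P w x
    rw [← mem_minSet.mp hi, ← fi_eq]
    exact le_ciSup (f := fun i => fi P w i x) (finite_range _).bddAbove i

lemma fi_le_f (i : Fin N) (x : EuclideanSpace ℝ (Fin n)) : fi P w i x ≤ f P w x :=
  le_ciSup (f := fun i => fi P w i x) (finite_range _).bddAbove i

/-- On Pow(α) the function f agrees with f_i, an affine minorant of f with gradient P_i, so the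
Legendre supremum at P_i is attained there. -/
lemma mem_Del_of_mem [Nonempty (Fin N)] {α : Finset (Fin N)} {i : Fin N} (hi : i ∈ α) :
    P i ∈ Del P w α := by
  intro x hx
  have hgx : gi P w i x = g P w x := by
    have hcl : IsClosed {x | gi P w i x = g P w x} :=
      isClosed_eq (continuous_gi P w i) (continuous_g P w)
    exact closure_minimal (fun y hy => hy.1 i hi) hcl hx
  have hfx : fi P w i x = f P w x := by rw [fi_eq, f_eq, hgx]
  have hleg : legendre (f P w) (P i) = ((inner ℝ (P i) x - f P w x : ℝ) : EReal) := by
    apply le_antisymm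
    · refine iSup_le fun y => EReal.coe_le_coe_iff.mpr ?_
      have := fi_le_f (P := P) (w := w) i y
      rw [← hfx]
      simp only [fi, real_inner_comm] at this ⊢
      linarith
    · exact le_iSup (fun y => ((inner ℝ (P i) y - f P w y : ℝ) : EReal)) x
  rw [hleg, ← EReal.coe_add, ← EReal.coe_sub, real_inner_comm, ← EReal.coe_zero]
  congr 1
  ring

/-- Such a ξ is a subgradient of f at c. In directions h orthogonal to all P_i − c, f is affine near
c with slope ⟨h, c⟩, so ξ − c is orthogonal to h. -/
lemma sub_mem_span_of_mem_Del [Nonempty (Fin N)] {c ξ : EuclideanSpace ℝ (Fin n)}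
    (hξ : ξ ∈ Del P w (minSet P w c)) :
    ξ - c ∈ Submodule.span ℝ ((fun i => P i - c) '' (minSet P w c : Set (Fin N))) := by
  set W := Submodule.span ℝ ((fun i => P i - c) '' (minSet P w c : Set (Fin N))) with hW
  have h1 := hξ c (mem_Pow_minSet c)
  have hsub : ∀ y, inner ℝ ξ y - f P w y ≤ inner ℝ c ξ - f P w c := by
    intro y
    have hle : ((inner ℝ ξ y - f P w y : ℝ) : EReal) ≤ legendre (f P w) ξ :=
      le_iSup (fun y => ((inner ℝ ξ y - f P w y : ℝ) : EReal)) y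
    -- An infinite Legendre value stays infinite after adding real terms, so the equation rules it
    -- out.
    have hleg : legendre (f P w) ξ = ((inner ℝ c ξ - f P w c : ℝ) : EReal) := by
      generalize legendre (f P w) ξ = L at h1
      induction L with
      | bot => simp at h1
      | top => simp at h1
      | coe L =>
        rw [← EReal.coe_add, ← EReal.coe_sub, ← EReal.coe_zero, EReal.coe_eq_coe_iff] at h1
        rw [EReal.coe_eq_coe_iff]
        linarith
    rw [hleg] at hle
    exact EReal.coe_le_coe_iff.mp hle
  rw [← Submodule.orthogonal_orthogonal W, Submodule.mem_orthogonal]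
  intro h hh
  have hhv : ∀ i ∈ minSet P w c, inner ℝ h (P i - c) = 0 := fun i hi =>
    Submodule.inner_left_of_mem_orthogonal (Submodule.subset_span ⟨i, hi, rfl⟩ : P i - c ∈ W) hh
  have hline : ∀ᶠ t in 𝓝 (0 : ℝ), t * inner ℝ h (ξ - c) ≤ 0 := by
    have hcont : ContinuousAt (fun t : ℝ => t • h) 0 := by fun_prop
    have := hcont.eventually (p := fun h => g P w (c + h) =
      g P w c + localModel (minSet P w c) (minSet_nonempty P w c) (fun i => P i - c) h)
      (by simpa using eventually_g_eq_localModel P w c)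
    filter_upwards [this] with t ht
    have hsup : (minSet P w c).sup' (minSet_nonempty P w c)
        (fun i => inner ℝ (t • h) (P i - c)) = 0 := by
      rw [Finset.sup'_congr (minSet_nonempty P w c) rfl fun i hi => by
        rw [real_inner_smul_left, hhv i hi, mul_zero]]
      exact Finset.sup'_const _ _
    simp only [localModel, hsup] at ht
    have h2 := hsub (c + t • h)
    rw [f_eq, f_eq, ht, norm_add_sq_real, inner_add_right, real_inner_smul_right,
      real_inner_smul_right, real_inner_comm c ξ, real_inner_comm h ξ, real_inner_comm h c] at h2
    rw [inner_sub_right]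
    linarith
  obtain ⟨ε, hε, hball⟩ := Metric.eventually_nhds_iff.mp hline
  have hp := hball (y := ε / 2) (by rw [dist_zero_right, Real.norm_of_nonneg (by positivity)]; linarith)
  have hn := hball (y := -(ε / 2)) (by
    rw [dist_zero_right, norm_neg, Real.norm_of_nonneg (by positivity)]; linarith)
  have hε2 : 0 < ε / 2 := by positivity
  apply le_antisymm <;> nlinarith

lemma cellDim_minSet [Nonempty (Fin N)] {c : EuclideanSpace ℝ (Fin n)}
    (hrel : HasPositiveRelation (fun i => P i - c) (minSet P w c)) :
    cellDim P w (minSet P w c) = Module.finrank ℝ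
      (Submodule.span ℝ ((fun i => P i - c) '' (minSet P w c : Set (Fin N)))) := by
  have h : vectorSpan ℝ (Del P w (minSet P w c)) =
      Submodule.span ℝ ((fun i => P i - c) '' (minSet P w c : Set (Fin N))) := by
    apply le_antisymm
    · rw [vectorSpan, Submodule.span_le]
      rintro _ ⟨ξ, hξ, η, hη, rfl⟩
      have := Submodule.sub_mem _ (sub_mem_span_of_mem_Del hξ) (sub_mem_span_of_mem_Del hη)
      simpa using this
    · rw [Submodule.span_le]
      rintro _ ⟨i, hi, rfl⟩
      obtain ⟨μ, hμ, hsum⟩ := hrel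
      have hS : 0 < ∑ j ∈ minSet P w c, μ j := Finset.sum_pos hμ ⟨i, hi⟩
      -- The relation eliminates c, expressing P_i − c through differences of points of the cell.
      have h1 : (∑ j ∈ minSet P w c, μ j) • (P i - c) =
          ∑ j ∈ minSet P w c, μ j • (P i - P j) := by
        have : ∀ j, μ j • (P i - P j) = μ j • (P i - c) - μ j • (P j - c) := by
          intro j; module
        simp only [this, Finset.sum_sub_distrib, hsum, sub_zero, Finset.sum_smul]
      have h2 : (∑ j ∈ minSet P w c, μ j) • (P i - c) ∈ vectorSpan ℝ (Del P w (minSet P w c)) := by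
        rw [h1]
        exact Submodule.sum_mem _ fun j hj => Submodule.smul_mem _ _
          (vsub_mem_vectorSpan ℝ (mem_Del_of_mem hi) (mem_Del_of_mem hj))
      exact (Submodule.smul_mem_iff _ hS.ne').mp h2
  rw [cellDim, h]

end Cells

end PowerDiagram

theorem mainTheorem2 {n N : ℕ} (P : Fin N → EuclideanSpace ℝ (Fin n)) (w : Fin N → ℝ)
    (hP : affineSpan ℝ (Set.range P) = ⊤) :
    PowerDiagram.IsTopMorse (PowerDiagram.g P w) ∧
    ∃ Φ : {α : Finset (Fin N) // PowerDiagram.IsActive P w α} ≃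
        {x : EuclideanSpace ℝ (Fin n) // PowerDiagram.IsTopCritical (PowerDiagram.g P w) x},
      ∀ α : {α : Finset (Fin N) // PowerDiagram.IsActive P w α},
        PowerDiagram.center P w α.1 = {(Φ α).1} ∧
        PowerDiagram.IsCriticalOfIndex (PowerDiagram.g P w) (Φ α).1
          (PowerDiagram.cellDim P w α.1) := by
  open PowerDiagram in
  have hN : Nonempty (Fin N) := by
    have h : (affineSpan ℝ (Set.range P) : Set (EuclideanSpace ℝ (Fin n))).Nonempty := by
      rw [hP]; exact ⟨0, trivial⟩
    rw [affineSpan_nonempty] at h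
    exact Set.range_nonempty_iff_nonempty.mp h
  refine ⟨⟨continuous_g P w, fun x hx => ⟨_, isCriticalOfIndex_of_hasPositiveRelation P w
    (hasPositiveRelation_of_isTopCritical P w hx)⟩⟩, ?_⟩
  have hex := fun α : {α : Finset (Fin N) // IsActive P w α} => α.2.exists_center
  choose c hc hmin hrel using hex
  have hrel' : ∀ α, HasPositiveRelation (fun i => P i - c α) (minSet P w (c α)) := fun α => by
    rw [hmin α]; exact hrel α
  have hidx : ∀ α : {α : Finset (Fin N) // IsActive P w α},
      IsCriticalOfIndex (g P w) (c α) (cellDim P w α.1) := fun α => by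
    have := isCriticalOfIndex_of_hasPositiveRelation P w (hrel' α)
    rwa [← cellDim_minSet (hrel' α), hmin α] at this
  refine ⟨Equiv.ofBijective (fun α => ⟨c α, (hidx α).1⟩) ⟨fun α β hαβ => ?_, fun x => ?_⟩,
    fun α => ⟨hc α, hidx α⟩⟩
  · have h := congrArg Subtype.val hαβ
    simp only at h
    exact Subtype.ext (by rw [← hmin α, ← hmin β, h])
  · have hx := hasPositiveRelation_of_isTopCritical P w x.2
    refine ⟨⟨_, isActive_minSet hx⟩, Subtype.ext ?_⟩
    have h1 := hc ⟨_, isActive_minSet hx⟩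
    rw [center_minSet hx] at h1
    exact (Set.singleton_injective h1).symm
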